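/- Let $K$ be a field of characteristic $0$. Let $a,b,c_0,c_1,\dots,c_L\in K[x,y]$ with $b,c_0,\dots,c_L\neq 0$, and let $e_1,\dots,e_L\in K\setminus\{0\}$. Assume that $\max\{\deg_x a,\deg_x b\}+\sum_{\ell}\deg_x c_\ell\neq 0$ and $\max\{\deg_y a,\deg_y b\}+\sum_{\ell}\deg_y c_\ell\neq 0$. Let $E$ be a field extension of $K(x,y)$ with two commuting derivations $D_x,D_y$ extending $\partial/\partial x$ and $\partial/\partial y$ on $K(x,y)$, and let $$h=c_0\exp\Bigl(\frac ab\Bigr)\prod_{\ell=1}^L c_\ell^{e_\ell}\in E\setminus\{0\},$$ meaning that $\frac{D h}{h}=\frac{D c_0}{c_0}+D\bigl(\frac ab\bigr)+\sum_\ell e_\ell\frac{D c_\ell}{c_\ell}$ for $D=D_x$ and for $D=D_y$. A nonzero $Q\in E$ is hyperexponential if $D_xQ/Q$ and $D_yQ/Q$ are in $K(x,y)$. A creative telescoping relation for $h$ of order $r$ and degree $d$ is an identity $$p_0h+p_1D_xh+\cdots+p_rD_x^rh=D_yQ$$ with $p_0,\dots,p_r\in K[x]$, $p_r\neq 0$,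 $\max_i\deg_x p_i=d$, and $Q\in E$ zero or hyperexponential. Let $b^*$ be a square free part of $b$ and put $$\alpha=\deg_x b^*+\deg_x b+\sum_{\ell}\deg_x c_\ell,\qquad \beta=\deg_x a-\deg_x b-1,\qquad \gamma=\deg_y b^*+\max\{\deg_y a,\deg_y b\}+\sum_{\ell}\deg_y c_\ell .$$ Say that condition (R) holds if $\frac ab\in K(x)$ and, for every $\ell$, $\deg_y c_\ell=0$ or $e_\ell\in\mathbb Z$; in this case $\eta=\sum_\ell e_\ell\deg_y c_\ell$ is an integer. Let $\phi_3\in\{0,1\}$ be either one of the following two flags: the flag that is $1$ exactly if (R) holds and $\deg_y c_0\ge\eta$; or the flag that is $1$ exactly if (R) holds and $\deg_y c_0+\eta+1\ge 0$. Then, for each of the two choices: 1. $h$ has a creative telescoping relation of order $r=\gamma-1+\phi_3$, and also one of order $r=\gamma+1-\phi_3$. 2. $h$ has a creative telescoping relation of degree $$d=\begin{cases}(\alpha+\beta)(2\gamma-1+\phi_3)+\gamma&\text{if }\deg_x a>\deg_x b,\\ \alpha(2\gamma-1+\phi_3)&\text{if }\deg_x a\le\deg_x b.\end{cases}$$ 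-/

import Mathlib

namespace CreativeTelescoping

/-- The polynomial ring `K[x, y]`; the variable `x` is `X 0`, the variable `y` is `X 1`. -/
abbrev Poly (K : Type*) [Field K] := MvPolynomial (Fin 2) K

/-- The field `K(x, y)` of bivariate rational functions. -/
abbrev RatXY (K : Type*) [Field K] := FractionRing (Poly K)

/-- The degree in `x`. It is a natural number, `0` for the zero polynomial. -/
noncomputable def degX {K : Type*} [Field K] (p : Poly K) : ℕ := MvPolynomial.degreeOf 0 p

/-- The degree in `y`. It is a natural number, `0` for the zero polynomial. -/
noncomputable def degY {K : Type*} [Field K] (p : Poly K) : ℕ := MvPolynomial.degreeOf 1 p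

/-- `s` is a square free part of `p`: it is square free and has the same irreducible factors. -/
def IsSquarefreePart {K : Type*} [Field K] (p s : Poly K) : Prop :=
  Squarefree s ∧ ∀ f : Poly K, Irreducible f → (f ∣ s ↔ f ∣ p)

/-- The inclusion of `K[x, y]` into an extension field `E` of `K(x, y)`. -/
noncomputable def incl (K E : Type*) [Field K] [Field E] [Algebra (RatXY K) E] : Poly K →+* E :=
  (algebraMap (RatXY K) E).comp (algebraMap (Poly K) (RatXY K))

/-- The inclusion of `K[x]` into an extension field `E` of `K(x, y)`. -/
noncomputable def inclX (K E : Type*) [Field K] [Field E] [Algebra (RatXY K) E] :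
    Polynomial K →+* E :=
  (incl K E).comp (Polynomial.aeval (MvPolynomial.X 0 : Poly K)).toRingHom

/-- The structure of a differential field extension of `K(x, y)` on a field `E` containing
`K(x, y)`: two commuting derivations of `E` which extend `∂/∂x` and `∂/∂y`. (A derivation that
vanishes on `K` is determined on `K(x, y)` by its values at `x` and `y`.) -/
structure DiffExt (K E : Type*) [Field K] [Field E] [Algebra K E] [Algebra (RatXY K) E] where
  Dx : Derivation K E E
  Dy : Derivation K E E
  Dx_x : Dx (incl K E (MvPolynomial.X 0)) = 1
  Dx_y : Dx (incl K E (MvPolynomial.X 1)) = 0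
  Dy_x : Dy (incl K E (MvPolynomial.X 0)) = 0
  Dy_y : Dy (incl K E (MvPolynomial.X 1)) = 1
  comm : ∀ z : E, Dx (Dy z) = Dy (Dx z)

section

variable {K E : Type*} [Field K] [Field E] [Algebra K E] [Algebra (RatXY K) E]

/-- A (nonzero) element of `E` is hyperexponential over `K(x, y)` if both its logarithmic
derivatives lie in `K(x, y)`. -/
def DiffExt.IsHyperexponential (D : DiffExt K E) (h : E) : Prop :=
  h ≠ 0 ∧ (∃ q : RatXY K, D.Dx h / h = algebraMap (RatXY K) E q) ∧
    (∃ q : RatXY K, D.Dy h / h = algebraMap (RatXY K) E q)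

/-- There is a creative telescoping relation
`p₀ h + p₁ Dx h + ⋯ + p_r Dx^r h = Dy Q` for `h` of order exactly `r` and degree exactly `d`:
the `p_i` are in `K[x]`, `p_r ≠ 0`, `d = max deg p_i`, and the certificate `Q` is zero or
a hyperexponential term. -/
def DiffExt.HasRelation (D : DiffExt K E) (h : E) (r d : ℕ) : Prop :=
  ∃ (p : Fin (r + 1) → Polynomial K) (Q : E),
    p (Fin.last r) ≠ 0 ∧
    Finset.univ.sup (fun i => (p i).natDegree) = d ∧
    (Q = 0 ∨ D.IsHyperexponential Q) ∧
    ∑ i : Fin (r + 1), inclX K E (p i) * (⇑D.Dx)^[(i : ℕ)] h = D.Dy Q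

end

/-- The data `a, b, c₀, …, c_L, e₁, …, e_L` of an expression `c₀ exp(a/b) ∏ c_ℓ ^ e_ℓ`, with the
standing nondegeneracy assumptions, and with a choice `bs` of the square free part of `b`. -/
structure TermData (K : Type*) [Field K] where
  a : Poly K
  b : Poly K
  bs : Poly K
  c₀ : Poly K
  L : ℕ
  c : Fin L → Poly K
  e : Fin L → K
  b_ne : b ≠ 0
  bs_sqfp : IsSquarefreePart b bs
  c₀_ne : c₀ ≠ 0
  c_ne : ∀ l, c l ≠ 0
  e_ne : ∀ l, e l ≠ 0
  degX_ne : max (degX a) (degX b) + ∑ l, degX (c l) ≠ 0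
  degY_ne : max (degY a) (degY b) + ∑ l, degY (c l) ≠ 0

namespace TermData

variable {K : Type*} [Field K] (T : TermData K)

/-- The nonzero element `h` of `E` is a term `c₀ exp(a/b) ∏ c_ℓ ^ e_ℓ`, i.e. its logarithmic
derivatives are those that this expression suggests. See `isTerm_of_prod` for elements that are
literally products of this form. -/
def IsTerm {E : Type*} [Field E] [Algebra K E] [Algebra (RatXY K) E]
    (D : DiffExt K E) (h : E) : Prop :=
  h ≠ 0 ∧
  D.Dx h / h = D.Dx (incl K E T.c₀) / incl K E T.c₀ + D.Dx (incl K E T.a / incl K E T.b) +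
    ∑ l, algebraMap K E (T.e l) * (D.Dx (incl K E (T.c l)) / incl K E (T.c l)) ∧
  D.Dy h / h = D.Dy (incl K E T.c₀) / incl K E T.c₀ + D.Dy (incl K E T.a / incl K E T.b) +
    ∑ l, algebraMap K E (T.e l) * (D.Dy (incl K E (T.c l)) / incl K E (T.c l))

theorem incl_injective (K E : Type*) [Field K] [Field E] [Algebra (RatXY K) E] :
    Function.Injective (incl K E) :=
  (algebraMap (RatXY K) E).injective.comp (IsFractionRing.injective (Poly K) (RatXY K))

theorem logDeriv_mul {K E : Type*} [Field K] [Field E] [Algebra K E] (D : Derivation K E E)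
    {f g : E} (hf : f ≠ 0) (hg : g ≠ 0) : D (f * g) / (f * g) = D f / f + D g / g := by
  rw [D.leibniz, smul_eq_mul, smul_eq_mul]
  field_simp
  ring

theorem logDeriv_prod {K E : Type*} [Field K] [Field E] [Algebra K E] (D : Derivation K E E)
    {n : ℕ} (w : Fin n → E) (hw : ∀ l, w l ≠ 0) (s : Finset (Fin n)) :
    D (∏ l ∈ s, w l) / ∏ l ∈ s, w l = ∑ l ∈ s, D (w l) / w l := by
  classical
  induction s using Finset.induction_on with
  | empty => simp
  | insert i s hi ih =>
    rw [Finset.prod_insert hi, Finset.sum_insert hi,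
      logDeriv_mul D (hw i) (Finset.prod_ne_zero_iff.2 fun l _ => hw l), ih]

/-- If `E` contains elements `u` and `w_ℓ` on which the derivations act as on `exp(a/b)` and on
`c_ℓ ^ e_ℓ`, then `c₀ u ∏ w_ℓ` is a term with the given data. -/
theorem isTerm_of_prod {E : Type*} [Field E] [Algebra K E] [Algebra (RatXY K) E]
    (D : DiffExt K E) (u : E) (w : Fin T.L → E) (hu : u ≠ 0) (hw : ∀ l, w l ≠ 0)
    (hux : D.Dx u = D.Dx (incl K E T.a / incl K E T.b) * u)
    (huy : D.Dy u = D.Dy (incl K E T.a / incl K E T.b) * u)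
    (hwx : ∀ l, D.Dx (w l) =
      algebraMap K E (T.e l) * (D.Dx (incl K E (T.c l)) / incl K E (T.c l)) * w l)
    (hwy : ∀ l, D.Dy (w l) =
      algebraMap K E (T.e l) * (D.Dy (incl K E (T.c l)) / incl K E (T.c l)) * w l) :
    T.IsTerm D (incl K E T.c₀ * u * ∏ l, w l) := by
  have hc : incl K E T.c₀ ≠ 0 := by
    rw [Ne, map_eq_zero_iff _ (incl_injective K E)]; exact T.c₀_ne
  have hp : ∏ l, w l ≠ 0 := Finset.prod_ne_zero_iff.2 fun l _ => hw l
  refine ⟨mul_ne_zero (mul_ne_zero hc hu) hp, ?_, ?_⟩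
  · rw [logDeriv_mul _ (mul_ne_zero hc hu) hp, logDeriv_mul _ hc hu, logDeriv_prod _ w hw, hux,
      mul_div_cancel_right₀ _ hu]
    congr 1
    exact Finset.sum_congr rfl fun l _ => by rw [hwx, mul_div_cancel_right₀ _ (hw l)]
  · rw [logDeriv_mul _ (mul_ne_zero hc hu) hp, logDeriv_mul _ hc hu, logDeriv_prod _ w hw, huy,
      mul_div_cancel_right₀ _ hu]
    congr 1
    exact Finset.sum_congr rfl fun l _ => by rw [hwy, mul_div_cancel_right₀ _ (hw l)]

noncomputable def alpha : ℤ := degX T.bs + degX T.b + ∑ l, degX (T.c l)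

/-- Only used when `deg_x a > deg_x b`. -/
noncomputable def beta : ℤ := degX T.a - degX T.b - 1

noncomputable def gamma : ℤ := degY T.bs + max (degY T.a) (degY T.b) + ∑ l, degY (T.c l)

/-- `h` is rational in `y` by its form: `a/b ∈ K(x)`, and `e_ℓ ∈ ℤ` whenever `deg_y c_ℓ ≠ 0`. -/
def RationalInY : Prop :=
  algebraMap (Poly K) (RatXY K) T.a / algebraMap (Poly K) (RatXY K) T.b ∈
      IntermediateField.adjoin K {algebraMap (Poly K) (RatXY K) (MvPolynomial.X 0)} ∧
    ∀ l, degY (T.c l) = 0 ∨ ∃ n : ℤ, (n : K) = T.e l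

/-- `η` is the integer `∑ e_ℓ deg_y c_ℓ` (when that sum, an element of `K`, is an integer). -/
def IsEta (η : ℤ) : Prop := (η : K) = ∑ l, T.e l * (degY (T.c l) : K)

open Classical in
/-- The flag `φ₃` with the inequality `deg_y c₀ ≥ ∑ e_ℓ deg_y c_ℓ`. -/
noncomputable def phi3 : ℤ :=
  if T.RationalInY ∧ ∃ η : ℤ, T.IsEta η ∧ η ≤ degY T.c₀ then 1 else 0

open Classical in
/-- The flag `φ₃` with the inequality `deg_y c₀ + ∑ e_ℓ deg_y c_ℓ + 1 ≥ 0`. -/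
noncomputable def phi3' : ℤ :=
  if T.RationalInY ∧ ∃ η : ℤ, T.IsEta η ∧ 0 ≤ degY T.c₀ + η + 1 then 1 else 0

end TermData

end CreativeTelescoping

/-! Split `h = c * H` with `c` a polynomial and `H` having logarithmic derivatives `U / w` and `V /
w`. Then `Dx ^ i h` is a polynomial over `w ^ i` times `H`, and for the ansatz `Q = q * w ^ (1 - r)
* H` so is `Dy Q`, over `w ^ r`. Clearing `w ^ r` turns a relation into a homogeneous linear system
over `K` for the coefficients of the `p_i` and of `q`.

A surplus of unknowns over equations gives a nonzero solution, but it might have all `p_i = 0`. Such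
solutions are the `q` with `certNum r q = 0`, a first order linear equation in `y`, so they span
dimension at most one over `K(x)`; the count has to pay `φ * (s + 1)` for them, with `φ ≤ 1`
(`KerBound`). If `γ` bounds the degrees in `y`, `μ` the degrees in `x` of `w` and `U`, and `ν` that
of `V`, the count succeeds for `r = γ - 1 + φ` with `d` large, and for `d ≥ max (μ * (γ - 1 + φ) + ν
* γ) ν` with `r` large.

It remains to save the one when the flag is `0` (`IsTerm.presentation_cases`). A nonzero `q` with
`certNum r q = 0` makes `a/b` plus a combination of logarithms have zero `y`-derivative. Double
poles force `a/b` to be free of `y`; residues show that a nonintegral `e_l` with `c_l` involving `y`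
produces a common factor of `w`, `U`, `V`; the behaviour at `y = ∞` gives `deg_y c₀ + η + 1 ≥ 0`. A
common factor is cancelled, and the drop of `γ` pays for `φ = 1`. The inequality contradicts the
second flag being `0`. If the first flag is `0`, then `η > deg_y c₀ ≥ 0`, so some `e_l` is a
positive integer; absorbing `c_l ^ e_l` into the polynomial part again lowers `γ`.

Bounds become exact values because applying `Dx` to a relation raises its order by one and
multiplying it by `x` raises its degree by one. -/

namespace CreativeTelescoping

open MvPolynomial

/-! ### Partial degrees, derivatives and prime factors -/

section Polynomials

variable {K : Type*} [Field K]

theorem coeff_X_mul_pderiv (i : Fin 2) (p : Poly K) (m : Fin 2 →₀ ℕ) :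
    coeff m (X i * pderiv i p) = (m i : K) * coeff m p := by
  induction p using MvPolynomial.induction_on' with
  | monomial u a =>
    rw [X_mul_pderiv_monomial, coeff_smul, coeff_monomial]
    split_ifs with h
    · subst h; simp
    · simp
  | add p q hp hq => rw [map_add, mul_add, coeff_add, hp, hq, coeff_add, mul_add]

theorem degreeOf_X_mul_pderiv_le (i j : Fin 2) (p : Poly K) :
    degreeOf j (X i * pderiv i p) ≤ degreeOf j p := by
  rw [degreeOf_le_iff]
  intro m hm
  refine monomial_le_degreeOf j ?_
  rw [mem_support_iff] at hm ⊢
  intro h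
  rw [coeff_X_mul_pderiv, h, mul_zero] at hm
  exact hm rfl

theorem degreeOf_le_degreeOf_X_mul (i j : Fin 2) (p : Poly K) :
    degreeOf j p ≤ degreeOf j (X i * p) := by
  rcases eq_or_ne p 0 with rfl | hp
  · simp
  · rw [degreeOf_mul_eq (X_ne_zero i) hp]; omega

theorem degreeOf_X_mul_self {i : Fin 2} {p : Poly K} (hp : p ≠ 0) :
    degreeOf i (X i * p) = degreeOf i p + 1 := by
  rw [degreeOf_mul_eq (X_ne_zero i) hp, degreeOf_X_self, add_comm]

theorem degreeOf_pderiv_le (i j : Fin 2) (p : Poly K) :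
    degreeOf j (pderiv i p) ≤ degreeOf j p :=
  (degreeOf_le_degreeOf_X_mul i j _).trans (degreeOf_X_mul_pderiv_le i j p)

theorem degreeOf_mul_le_of_le {j : Fin 2} {p q : Poly K} {m n : ℕ} (hp : degreeOf j p ≤ m)
    (hq : degreeOf j q ≤ n) : degreeOf j (p * q) ≤ m + n :=
  (degreeOf_mul_le j p q).trans (add_le_add hp hq)

theorem degreeOf_add_le_of_le {j : Fin 2} {p q : Poly K} {m : ℕ} (hp : degreeOf j p ≤ m)
    (hq : degreeOf j q ≤ m) : degreeOf j (p + q) ≤ m :=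
  (degreeOf_add_le j p q).trans (max_le hp hq)

theorem degreeOf_sub_le_of_le {j : Fin 2} {p q : Poly K} {m : ℕ} (hp : degreeOf j p ≤ m)
    (hq : degreeOf j q ≤ m) : degreeOf j (p - q) ≤ m :=
  (degreeOf_sub_le j p q).trans (max_le hp hq)

theorem degreeOf_sum_le_of_le {ι : Type*} {s : Finset ι} {j : Fin 2} {p : ι → Poly K} {m : ℕ}
    (hp : ∀ i ∈ s, degreeOf j (p i) ≤ m) : degreeOf j (∑ i ∈ s, p i) ≤ m :=
  (degreeOf_sum_le j s p).trans (Finset.sup_le hp)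

theorem degreeOf_C_mul_le_of_le {j : Fin 2} {p : Poly K} {m : ℕ} (a : K)
    (hp : degreeOf j p ≤ m) : degreeOf j (C a * p) ≤ m :=
  (degreeOf_C_mul_le p j a).trans hp

theorem degreeOf_le_of_dvd {j : Fin 2} {p q : Poly K} (hq : q ≠ 0) (h : p ∣ q) :
    degreeOf j p ≤ degreeOf j q := by
  obtain ⟨r, rfl⟩ := h
  rw [degreeOf_mul_eq (left_ne_zero_of_mul hq) (right_ne_zero_of_mul hq)]
  omega

/-- Passing from `p` to `y * p_y - (deg_y p) * p` lowers the degree in `y`. -/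
theorem degreeOf_X_mul_euler_le (i : Fin 2) (p : Poly K) :
    degreeOf i (X i * (X i * pderiv i p - C (degreeOf i p : K) * p)) ≤ degreeOf i p := by
  rcases eq_or_ne (X i * pderiv i p - C (degreeOf i p : K) * p) 0 with h | h
  · rw [h, mul_zero, degreeOf_zero]; omega
  rw [degreeOf_X_mul_self h, Nat.succ_le_iff]
  have key : ∀ m ∈ (X i * pderiv i p - C (degreeOf i p : K) * p).support,
      m i < degreeOf i p := by
    intro m hm
    rw [mem_support_iff, coeff_sub, coeff_X_mul_pderiv, coeff_C_mul, ← sub_mul] at hm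
    refine lt_of_le_of_ne (monomial_le_degreeOf i (mem_support_iff.2 (right_ne_zero_of_mul hm))) ?_
    intro h'
    rw [h', sub_self, zero_mul] at hm
    exact hm rfl
  obtain ⟨m, hm⟩ := support_nonempty.2 h
  rw [degreeOf_lt_iff ((Nat.zero_le _).trans_lt (key m hm))]
  exact key

theorem pderiv_eq_zero_of_degreeOf {i : Fin 2} {p : Poly K} (h : degreeOf i p = 0) :
    pderiv i p = 0 := by
  by_contra h'
  have := degreeOf_X_mul_pderiv_le i i p
  rw [degreeOf_X_mul_self h', h] at this
  omega

theorem degreeOf_eq_zero_of_pderiv [CharZero K] {i : Fin 2} {p : Poly K} (h : pderiv i p = 0) :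
    degreeOf i p = 0 := by
  rw [← Nat.le_zero, degreeOf_le_iff]
  intro m hm
  have := coeff_X_mul_pderiv i p m
  rw [h, mul_zero, coeff_zero] at this
  rcases mul_eq_zero.1 this.symm with h | h
  · exact (Nat.cast_eq_zero.1 h).le
  · exact absurd h (mem_support_iff.1 hm)

/-- In characteristic zero the derivative is nonzero and has smaller degree in the variable of
differentiation. This makes residues at `f` detectable modulo `f`. -/
theorem not_dvd_pderiv [CharZero K] {i : Fin 2} {f : Poly K} (hf : degreeOf i f ≠ 0) :
    ¬ f ∣ pderiv i f := by
  intro h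
  have h0 : pderiv i f ≠ 0 := fun h0 => hf (degreeOf_eq_zero_of_pderiv h0)
  have h1 := degreeOf_le_of_dvd (j := i) h0 h
  have h2 := degreeOf_X_mul_pderiv_le i i f
  rw [degreeOf_X_mul_self h0] at h2
  omega

theorem degreeOf_eq_zero_of_isUnit {i : Fin 2} {p : Poly K} (h : IsUnit p) : degreeOf i p = 0 := by
  have := degreeOf_le_of_dvd (j := i) one_ne_zero h.dvd
  rw [degreeOf_one] at this
  omega

theorem exists_prime_dvd_degreeOf_ne {i : Fin 2} {p : Poly K} (h : degreeOf i p ≠ 0) :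
    ∃ f, Prime f ∧ f ∣ p ∧ degreeOf i f ≠ 0 := by
  induction p using UniqueFactorizationMonoid.induction_on_prime with
  | h₁ => simp at h
  | h₂ x hx => exact absurd (degreeOf_eq_zero_of_isUnit hx) h
  | h₃ a p ha hp ih =>
    by_cases h' : degreeOf i p = 0
    · rw [degreeOf_mul_eq hp.ne_zero ha, h', zero_add] at h
      obtain ⟨f, h1, h2, h3⟩ := ih h
      exact ⟨f, h1, h2.mul_left _, h3⟩
    · exact ⟨p, hp, dvd_mul_right _ _, h'⟩

theorem exists_eq_prime_pow_mul {f p : Poly K} (hf : Prime f) (hp : p ≠ 0) :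
    ∃ (n : ℕ) (g : Poly K), ¬ f ∣ g ∧ p = f ^ n * g := by
  obtain ⟨g, h1, h2⟩ :=
    (FiniteMultiplicity.of_not_isUnit hf.not_isUnit hp).exists_eq_pow_mul_and_not_dvd
  exact ⟨_, g, h2, h1⟩

/-- A polynomial divides the product of its derivative with any polynomial that has all its
irreducible factors. -/
theorem dvd_mul_pderiv (i : Fin 2) {b s : Poly K} (hb : b ≠ 0)
    (h : ∀ f, Irreducible f → f ∣ b → f ∣ s) : b ∣ s * pderiv i b := by
  induction b using UniqueFactorizationMonoid.induction_on_prime with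
  | h₁ => exact absurd rfl hb
  | h₂ x hx => exact hx.dvd
  | h₃ a p ha hp ih =>
    rw [pderiv_mul, mul_add]
    refine dvd_add ?_ ?_
    · obtain ⟨t, rfl⟩ := h p hp.irreducible (dvd_mul_right _ _)
      exact ⟨t * pderiv i p, by ring⟩
    · obtain ⟨t, ht⟩ := ih ha fun f hf hfa => h f hf (hfa.mul_left _)
      exact ⟨t, by rw [mul_left_comm, ht]; ring⟩

end Polynomials

/-! ### Telescoping relations: from bounds to exact order and degree -/

section Relations

variable {K E : Type*} [Field K] [Field E] [Algebra K E] [Algebra (RatXY K) E]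

theorem incl_ne_zero {K E : Type*} [Field K] [Field E] [Algebra (RatXY K) E]
    {p : Poly K} (hp : p ≠ 0) : incl K E p ≠ 0 := by
  rwa [Ne, map_eq_zero_iff _ (TermData.incl_injective K E)]

theorem inclX_apply {K E : Type*} [Field K] [Field E] [Algebra (RatXY K) E] (p : Polynomial K) :
    inclX K E p = incl K E (Polynomial.aeval (X 0 : Poly K) p) := rfl

theorem incl_C [IsScalarTower K (RatXY K) E] (k : K) : incl K E (C k) = algebraMap K E k := by
  rw [IsScalarTower.algebraMap_apply K (RatXY K) E,
    IsScalarTower.algebraMap_apply K (Poly K) (RatXY K)]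
  rfl

theorem derivation_incl [IsScalarTower K (RatXY K) E] (δ : Derivation K E E) (i : Fin 2)
    (h1 : δ (incl K E (X i)) = 1) (h0 : ∀ j ≠ i, δ (incl K E (X j)) = 0) (p : Poly K) :
    δ (incl K E p) = incl K E (pderiv i p) := by
  induction p using MvPolynomial.induction_on with
  | C a => rw [incl_C, Derivation.map_algebraMap, pderiv_C, map_zero]
  | add p q hp hq => simp only [map_add, hp, hq]
  | mul_X p j hp =>
    rw [map_mul, Derivation.leibniz, hp, pderiv_mul, smul_eq_mul, smul_eq_mul, map_add, map_mul,
      map_mul]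
    rcases eq_or_ne j i with rfl | hj
    · rw [h1, pderiv_X_self, map_one]; ring
    · rw [h0 j hj, pderiv_X_of_ne hj, map_zero]; ring

theorem DiffExt.Dx_incl [IsScalarTower K (RatXY K) E] (D : DiffExt K E) (p : Poly K) :
    D.Dx (incl K E p) = incl K E (pderiv 0 p) :=
  derivation_incl D.Dx 0 D.Dx_x (fun j hj => by
    obtain rfl : j = 1 := by omega
    exact D.Dx_y) p

theorem DiffExt.Dy_incl [IsScalarTower K (RatXY K) E] (D : DiffExt K E) (p : Poly K) :
    D.Dy (incl K E p) = incl K E (pderiv 1 p) :=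
  derivation_incl D.Dy 1 D.Dy_y (fun j hj => by
    obtain rfl : j = 0 := by omega
    exact D.Dy_x) p

theorem DiffExt.Dx_inclX [IsScalarTower K (RatXY K) E] (D : DiffExt K E) (p : Polynomial K) :
    D.Dx (inclX K E p) = inclX K E (Polynomial.derivative p) := by
  rw [inclX_apply, inclX_apply, D.Dx_incl, Derivation.map_aeval, pderiv_X_self, smul_eq_mul,
    mul_one]

theorem DiffExt.Dy_inclX [IsScalarTower K (RatXY K) E] (D : DiffExt K E) (p : Polynomial K) :
    D.Dy (inclX K E p) = 0 := by
  rw [inclX_apply, D.Dy_incl, Derivation.map_aeval, pderiv_X_of_ne (by decide), smul_zero,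
    map_zero]

namespace DiffExt

variable {D : DiffExt K E}

theorem IsHyperexponential.mul {g h : E} (hg : D.IsHyperexponential g)
    (hh : D.IsHyperexponential h) : D.IsHyperexponential (g * h) := by
  obtain ⟨hg0, ⟨u, hu⟩, ⟨v, hv⟩⟩ := hg
  obtain ⟨hh0, ⟨u', hu'⟩, ⟨v', hv'⟩⟩ := hh
  refine ⟨mul_ne_zero hg0 hh0, ⟨u + u', ?_⟩, ⟨v + v', ?_⟩⟩
  · rw [TermData.logDeriv_mul _ hg0 hh0, hu, hu', map_add]
  · rw [TermData.logDeriv_mul _ hg0 hh0, hv, hv', map_add]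

theorem isHyperexponential_incl [IsScalarTower K (RatXY K) E] (D : DiffExt K E) {p : Poly K}
    (hp : p ≠ 0) : D.IsHyperexponential (incl K E p) :=
  ⟨incl_ne_zero hp,
    ⟨algebraMap (Poly K) (RatXY K) (pderiv 0 p) / algebraMap (Poly K) (RatXY K) p, by
      rw [D.Dx_incl, map_div₀]; rfl⟩,
    ⟨algebraMap (Poly K) (RatXY K) (pderiv 1 p) / algebraMap (Poly K) (RatXY K) p, by
      rw [D.Dy_incl, map_div₀]; rfl⟩⟩

theorem IsHyperexponential.inv {g : E} (hg : D.IsHyperexponential g) :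
    D.IsHyperexponential g⁻¹ := by
  obtain ⟨hg0, ⟨u, hu⟩, ⟨v, hv⟩⟩ := hg
  have key : ∀ δ : Derivation K E E, δ g⁻¹ / g⁻¹ = -(δ g / g) := fun δ => by
    have := TermData.logDeriv_mul δ hg0 (inv_ne_zero hg0)
    rw [mul_inv_cancel₀ hg0, δ.map_one_eq_zero, zero_div] at this
    linear_combination -this
  exact ⟨inv_ne_zero hg0, ⟨-u, by rw [key, hu, map_neg]⟩, ⟨-v, by rw [key, hv, map_neg]⟩⟩

theorem IsHyperexponential.Dx [IsScalarTower K (RatXY K) E] {g : E}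
    (hg : D.IsHyperexponential g) : D.Dx g = 0 ∨ D.IsHyperexponential (D.Dx g) := by
  rw [or_iff_not_imp_left]
  intro h0
  obtain ⟨u, hu⟩ := hg.2.1
  have hx : D.Dx g = algebraMap (RatXY K) E u * g := by rw [← hu, div_mul_cancel₀ _ hg.1]
  obtain ⟨p, q, hq, rfl⟩ := IsFractionRing.div_surjective (A := Poly K) u
  have hq0 : q ≠ 0 := nonZeroDivisors.ne_zero hq
  have hp0 : p ≠ 0 := by
    rintro rfl
    simp [hx] at h0
  rw [hx, map_div₀, div_eq_mul_inv]
  exact ((isHyperexponential_incl D hp0).mul (isHyperexponential_incl D hq0).inv).mul hg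

variable (D)

/-- A creative telescoping relation of order at most `r` and degree at most `d`. -/
def HasRelationLE (h : E) (r d : ℕ) : Prop :=
  ∃ (p : ℕ → Polynomial K) (Q : E), (∃ i ≤ r, p i ≠ 0) ∧ (∀ i ≤ r, (p i).natDegree ≤ d) ∧
    (Q = 0 ∨ D.IsHyperexponential Q) ∧
    ∑ i ∈ Finset.range (r + 1), inclX K E (p i) * (⇑D.Dx)^[i] h = D.Dy Q

variable {D}

theorem hasRelation_of_sum {h : E} {r : ℕ} {p : ℕ → Polynomial K} {Q : E} (hp : p r ≠ 0)
    (hQ : Q = 0 ∨ D.IsHyperexponential Q)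
    (hs : ∑ i ∈ Finset.range (r + 1), inclX K E (p i) * (⇑D.Dx)^[i] h = D.Dy Q) :
    D.HasRelation h r (Finset.univ.sup fun i : Fin (r + 1) => (p i).natDegree) :=
  ⟨fun i => p i, Q, by simpa using hp, rfl, hQ, by
    rw [← hs, Finset.sum_range fun i => inclX K E (p i) * (⇑D.Dx)^[i] h]⟩

theorem HasRelationLE.exists_hasRelation {h : E} {r d : ℕ} (H : D.HasRelationLE h r d) :
    ∃ r' ≤ r, ∃ d' ≤ d, D.HasRelation h r' d' := by
  obtain ⟨p, Q, h0, hd, hQ, hs⟩ := H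
  induction r with
  | zero =>
    obtain ⟨i, hi, h0⟩ := h0
    obtain rfl := Nat.le_zero.1 hi
    exact ⟨0, le_rfl, _, Finset.sup_le fun (i : Fin _) _ => hd i i.is_le,
      hasRelation_of_sum h0 hQ hs⟩
  | succ r ih =>
    by_cases hr : p (r + 1) = 0
    · obtain ⟨r', h1, h2⟩ := ih
        (by
          obtain ⟨i, hi, h0⟩ := h0
          refine ⟨i, ?_, h0⟩
          rcases hi.lt_or_eq with h | rfl
          · omega
          · exact absurd hr h0)
        (fun i hi => hd i (by omega))
        (by rw [← hs, Finset.sum_range_succ _ (r + 1), hr, map_zero, zero_mul, add_zero])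
      exact ⟨r', by omega, h2⟩
    · exact ⟨r + 1, le_rfl, _, Finset.sup_le fun (i : Fin _) _ => hd i i.is_le,
        hasRelation_of_sum hr hQ hs⟩

/-- Apply `Dx`, which commutes with `Dy`: the new coefficients are `p_i' + p_(i-1)`, so the old
leading coefficient leads again. -/
theorem HasRelation.order_succ [IsScalarTower K (RatXY K) E] {h : E} {r d : ℕ}
    (H : D.HasRelation h r d) : ∃ d', D.HasRelation h (r + 1) d' := by
  obtain ⟨p, Q, h0, -, hQ, hs⟩ := H
  let p' : ℕ → Polynomial K := fun i => if hi : i < r + 1 then p ⟨i, hi⟩ else 0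
  have hp' : ∀ i : Fin (r + 1), p' i = p i := fun i => dif_pos i.2
  have hlast : p' (r + 1) = 0 := by simp [p']
  let q : ℕ → Polynomial K := fun i =>
    Polynomial.derivative (p' i) + if i = 0 then 0 else p' (i - 1)
  refine ⟨_, hasRelation_of_sum (p := q) (Q := D.Dx Q) ?_ ?_ ?_⟩
  · have : q (r + 1) = p (Fin.last r) := by
      simp [q, hlast, ← hp']
    rwa [this]
  · rcases hQ with rfl | hQ
    · exact Or.inl (map_zero _)
    · exact hQ.Dx
  · rw [← D.comm, ← hs, map_sum]
    simp only [q, map_add, add_mul, Finset.sum_add_distrib]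
    rw [Finset.sum_range_succ _ (r + 1), Finset.sum_range_succ' (fun i =>
      inclX K E (if i = 0 then 0 else p' (i - 1)) * (⇑D.Dx)^[i] h), hlast]
    simp only [map_zero, zero_mul, add_zero, if_true, Nat.succ_ne_zero, if_false,
      Nat.add_sub_cancel]
    rw [← Finset.sum_add_distrib, Finset.sum_range]
    refine Finset.sum_congr rfl fun i _ => ?_
    rw [hp', Derivation.leibniz, D.Dx_inclX, smul_eq_mul, smul_eq_mul,
      Function.iterate_succ_apply']
    ring

theorem HasRelation.order_le [IsScalarTower K (RatXY K) E] {h : E} {r r' d : ℕ}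
    (H : D.HasRelation h r d) (hr : r ≤ r') : ∃ d', D.HasRelation h r' d' := by
  induction r', hr using Nat.le_induction with
  | base => exact ⟨d, H⟩
  | succ r' _ ih => exact ih.choose_spec.order_succ

/-- Multiply by `x`, a constant for `Dy`. -/
theorem HasRelation.degree_succ [IsScalarTower K (RatXY K) E] {h : E} {r d : ℕ}
    (H : D.HasRelation h r d) : D.HasRelation h r (d + 1) := by
  obtain ⟨p, Q, h0, hd, hQ, hs⟩ := H
  refine ⟨fun i => Polynomial.X * p i, inclX K E Polynomial.X * Q,
    mul_ne_zero Polynomial.X_ne_zero h0,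
    le_antisymm ?_ ?_, ?_, ?_⟩
  · refine Finset.sup_le fun i _ => ?_
    have h1 : (p i).natDegree ≤ d :=
      hd ▸ Finset.le_sup (f := fun i => (p i).natDegree) (Finset.mem_univ i)
    have h2 := Polynomial.natDegree_mul_le (p := Polynomial.X) (q := p i)
    rw [Polynomial.natDegree_X] at h2
    exact h2.trans (by omega)
  -- The maximum has to be attained at a nonzero coefficient: a zero coefficient also has
  -- `natDegree` zero, which multiplication by `x` does not raise.
  · have key : ∃ i, p i ≠ 0 ∧ (p i).natDegree = d := by
      obtain ⟨i, -, hi⟩ := Finset.exists_mem_eq_sup Finset.univ Finset.univ_nonempty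
        fun i => (p i).natDegree
      rw [hd] at hi
      by_cases hpi : p i = 0
      · rw [hpi, Polynomial.natDegree_zero] at hi
        refine ⟨_, h0, ?_⟩
        have : (p (Fin.last r)).natDegree ≤ d :=
          hd ▸ Finset.le_sup (f := fun i => (p i).natDegree) (Finset.mem_univ _)
        omega
      · exact ⟨i, hpi, hi.symm⟩
    obtain ⟨i, hi, hid⟩ := key
    rw [← hid, ← Polynomial.natDegree_X_mul hi]
    exact Finset.le_sup (f := fun i => (Polynomial.X * p i).natDegree) (Finset.mem_univ i)
  · rcases hQ with rfl | hQ
    · exact Or.inl (mul_zero _)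
    · rw [inclX_apply, Polynomial.aeval_X]
      exact Or.inr ((isHyperexponential_incl D (X_ne_zero 0)).mul hQ)
  · rw [Derivation.leibniz, D.Dy_inclX, smul_zero, add_zero, smul_eq_mul, ← hs, Finset.mul_sum]
    exact Finset.sum_congr rfl fun i _ => by rw [map_mul, mul_assoc]

theorem HasRelation.degree_le [IsScalarTower K (RatXY K) E] {h : E} {r d d' : ℕ}
    (H : D.HasRelation h r d) (hd : d ≤ d') : D.HasRelation h r d' := by
  induction d', hd using Nat.le_induction with
  | base => exact H
  | succ d' _ ih => exact ih.degree_succ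

theorem HasRelationLE.exists_hasRelation_order [IsScalarTower K (RatXY K) E] {h : E} {r r' d : ℕ}
    (H : D.HasRelationLE h r d) (hr : r ≤ r') : ∃ d', D.HasRelation h r' d' := by
  obtain ⟨r₀, h1, d₀, -, h2⟩ := H.exists_hasRelation
  exact h2.order_le (h1.trans hr)

theorem HasRelationLE.exists_hasRelation_degree [IsScalarTower K (RatXY K) E] {h : E}
    {r d d' : ℕ} (H : D.HasRelationLE h r d) (hd : d ≤ d') : ∃ r', D.HasRelation h r' d' := by
  obtain ⟨r₀, -, d₀, h1, h2⟩ := H.exists_hasRelation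
  exact ⟨r₀, h2.degree_le (h1.trans hd)⟩

end DiffExt

end Relations

/-- Modulo the range of `g` the target is smaller than `P`, so `f` acquires a kernel there. This
yields `p ≠ 0`, not merely a nonzero pair. -/
theorem exists_eq_of_finrank_lt {K P Q T : Type*} [Field K] [AddCommGroup P] [Module K P]
    [AddCommGroup Q] [Module K Q] [AddCommGroup T] [Module K T] [FiniteDimensional K P]
    [FiniteDimensional K Q] [FiniteDimensional K T] (f : P →ₗ[K] T) (g : Q →ₗ[K] T)
    (h : Module.finrank K T + Module.finrank K (LinearMap.ker g) <
      Module.finrank K P + Module.finrank K Q) : ∃ p q, p ≠ 0 ∧ f p = g q := by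
  have h1 := (LinearMap.range g).finrank_quotient_add_finrank
  have h2 := LinearMap.finrank_range_add_finrank_ker g
  have h3 : LinearMap.ker ((LinearMap.range g).mkQ.comp f) ≠ ⊥ :=
    LinearMap.ker_ne_bot_of_finrank_lt (by omega)
  obtain ⟨p, hp, hp0⟩ := Submodule.exists_mem_ne_zero_of_ne_bot h3
  rw [LinearMap.mem_ker, LinearMap.comp_apply, Submodule.mkQ_apply,
    Submodule.Quotient.mk_eq_zero] at hp
  obtain ⟨q, hq⟩ := hp
  exact ⟨p, q, hp0, hq.symm⟩

/-! ### Polynomials in a degree box as coefficient vectors -/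

section Coordinates

variable (K : Type*) [Field K]

/-- The exponent vector of `x ^ i * y ^ j`. -/
noncomputable def expXY (i j : ℕ) : Fin 2 →₀ ℕ := Finsupp.single 0 i + Finsupp.single 1 j

theorem expXY_zero (i j : ℕ) : expXY i j 0 = i := by simp [expXY]

theorem expXY_one (i j : ℕ) : expXY i j 1 = j := by simp [expXY]

theorem expXY_eta (m : Fin 2 →₀ ℕ) : expXY (m 0) (m 1) = m := by
  ext k
  fin_cases k
  · exact expXY_zero _ _
  · exact expXY_one _ _

/-- The polynomial of degree less than `s` in `x` and less than `n` in `y` with given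
coefficients. -/
noncomputable def ofCoeffs (s n : ℕ) : (Fin s × Fin n → K) →ₗ[K] Poly K :=
  Fintype.linearCombination K fun ij => monomial (expXY ij.1 ij.2) 1

/-- The coefficients at the monomials of degree less than `s` in `x` and less than `n` in `y`. -/
noncomputable def coeffs (s n : ℕ) : Poly K →ₗ[K] (Fin s × Fin n → K) :=
  LinearMap.pi fun ij => lcoeff K (expXY ij.1 ij.2)

variable {K}

theorem ofCoeffs_apply (s n : ℕ) (f : Fin s × Fin n → K) :
    ofCoeffs K s n f = ∑ ij, monomial (expXY ij.1 ij.2) (f ij) := by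
  simp [ofCoeffs, Fintype.linearCombination_apply, smul_monomial]

theorem coeffs_apply (s n : ℕ) (p : Poly K) (ij : Fin s × Fin n) :
    coeffs K s n p ij = coeff (expXY ij.1 ij.2) p := rfl

theorem coeffs_ofCoeffs (s n : ℕ) (f : Fin s × Fin n → K) :
    coeffs K s n (ofCoeffs K s n f) = f := by
  ext ij
  rw [coeffs_apply, ofCoeffs_apply, coeff_sum, Finset.sum_eq_single ij]
  · rw [coeff_monomial, if_pos rfl]
  · intro kl _ hkl
    rw [coeff_monomial, if_neg]
    intro h
    refine hkl (Prod.ext (Fin.ext ?_) (Fin.ext ?_))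
    · rw [← expXY_zero kl.1 kl.2, h, expXY_zero]
    · rw [← expXY_one kl.1 kl.2, h, expXY_one]
  · exact fun h => absurd (Finset.mem_univ _) h

theorem ofCoeffs_injective (s n : ℕ) : Function.Injective (ofCoeffs K s n) :=
  Function.LeftInverse.injective (coeffs_ofCoeffs s n)

theorem degreeOf_ofCoeffs_zero_le (s n : ℕ) (f : Fin (s + 1) × Fin n → K) :
    degreeOf 0 (ofCoeffs K (s + 1) n f) ≤ s := by
  rw [ofCoeffs_apply]
  refine degreeOf_sum_le_of_le fun ij _ => ?_
  by_cases h : f ij = 0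
  · simp [h]
  · rw [degreeOf_monomial_eq _ _ h, expXY_zero]
    exact ij.1.is_le

theorem degreeOf_ofCoeffs_one_le (s n : ℕ) (f : Fin s × Fin (n + 1) → K) :
    degreeOf 1 (ofCoeffs K s (n + 1) f) ≤ n := by
  rw [ofCoeffs_apply]
  refine degreeOf_sum_le_of_le fun ij _ => ?_
  by_cases h : f ij = 0
  · simp [h]
  · rw [degreeOf_monomial_eq _ _ h, expXY_one]
    exact ij.2.is_le

theorem exists_coeff_ne_zero_of_degreeOf {i : Fin 2} {p : Poly K} (hp : p ≠ 0) :
    ∃ m ∈ p.support, m i = degreeOf i p := by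
  obtain ⟨m, hm, h⟩ := Finset.exists_mem_eq_sup p.support (support_nonempty.2 hp) fun m => m i
  exact ⟨m, hm, by rw [degreeOf_eq_sup, h]⟩

theorem eq_zero_of_coeffs_eq_zero {s n : ℕ} {p : Poly K} (h0 : degreeOf 0 p < s)
    (h1 : degreeOf 1 p < n) (h : coeffs K s n p = 0) : p = 0 := by
  ext m
  by_contra hm
  have hm' : m ∈ p.support := mem_support_iff.2 (by simpa using hm)
  have h2 := (monomial_le_degreeOf 0 hm').trans_lt h0
  have h3 := (monomial_le_degreeOf 1 hm').trans_lt h1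
  have := congr_fun h (⟨m 0, h2⟩, ⟨m 1, h3⟩)
  rw [coeffs_apply, expXY_eta] at this
  exact hm this

/-- The polynomial in one variable of degree at most `d` with given coefficients. -/
noncomputable def polyOfCoeffs (K : Type*) [Field K] (d : ℕ) :
    (Fin (d + 1) → K) →ₗ[K] Polynomial K :=
  (Polynomial.degreeLT K (d + 1)).subtype.comp
    (Polynomial.degreeLTEquiv K (d + 1)).symm.toLinearMap

theorem polyOfCoeffs_ne_zero {d : ℕ} {f : Fin (d + 1) → K} (hf : f ≠ 0) :
    polyOfCoeffs K d f ≠ 0 := by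
  simpa [polyOfCoeffs] using hf

theorem natDegree_polyOfCoeffs_le (d : ℕ) (f : Fin (d + 1) → K) :
    (polyOfCoeffs K d f).natDegree ≤ d := by
  have : polyOfCoeffs K d f ∈ Polynomial.degreeLT K (d + 1) :=
    ((Polynomial.degreeLTEquiv K (d + 1)).symm f).2
  rw [Polynomial.degreeLT_succ_eq_degreeLE, Polynomial.mem_degreeLE] at this
  exact Polynomial.natDegree_le_of_degree_le this

theorem degreeOf_zero_aeval_le (p : Polynomial K) :
    degreeOf 0 (Polynomial.aeval (X 0 : Poly K) p) ≤ p.natDegree := by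
  rw [Polynomial.aeval_eq_sum_range]
  refine degreeOf_sum_le_of_le fun i hi => ?_
  rw [smul_eq_C_mul]
  refine degreeOf_C_mul_le_of_le _ ?_
  rw [degreeOf_X_self_pow]
  exact Nat.lt_succ_iff.1 (Finset.mem_range.1 hi)

theorem degreeOf_one_aeval (p : Polynomial K) :
    degreeOf 1 (Polynomial.aeval (X 0 : Poly K) p) = 0 := by
  rw [← Nat.le_zero, Polynomial.aeval_eq_sum_range]
  refine degreeOf_sum_le_of_le fun i hi => ?_
  rw [smul_eq_C_mul]
  refine degreeOf_C_mul_le_of_le _ ?_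
  rw [degreeOf_X_pow_of_ne _ (by decide)]

end Coordinates

/-- With different degrees, the top coefficient of `X i * (p * q' - q * p')` would be the difference
of the degrees times the leading coefficients, nonzero in characteristic zero. -/
theorem degreeOf_eq_of_mul_pderiv_eq {K : Type*} [Field K] [CharZero K] {i : Fin 2}
    {p q : Poly K} (hp : p ≠ 0) (hq : q ≠ 0) (h : p * pderiv i q = q * pderiv i p) :
    degreeOf i p = degreeOf i q := by
  by_contra hne
  have hc : (degreeOf i q : K) - degreeOf i p ≠ 0 := by
    rw [sub_ne_zero]
    exact fun h => hne (Nat.cast_injective h).symm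
  have key : X i * (C ((degreeOf i q : K) - degreeOf i p) * (p * q)) =
      X i * (X i * pderiv i p - C (degreeOf i p : K) * p) * q -
      p * (X i * (X i * pderiv i q - C (degreeOf i q : K) * q)) := by
    rw [C_sub]
    linear_combination (X i * X i) * h
  have h1 : degreeOf i (X i * (C ((degreeOf i q : K) - degreeOf i p) * (p * q))) ≤
      degreeOf i p + degreeOf i q := by
    rw [key]
    exact degreeOf_sub_le_of_le (degreeOf_mul_le_of_le (degreeOf_X_mul_euler_le i p) le_rfl)
      (degreeOf_mul_le_of_le le_rfl (degreeOf_X_mul_euler_le i q))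
  have hpq := mul_ne_zero hp hq
  rw [degreeOf_X_mul_self (mul_ne_zero ((map_ne_zero_iff _ (C_injective _ _)).2 hc) hpq),
    degreeOf_mul_eq ((map_ne_zero_iff _ (C_injective _ _)).2 hc) hpq, degreeOf_C,
    degreeOf_mul_eq hp hq] at h1
  omega

/-! ### Numerators of derivatives and of certificates -/

section Presentation

variable {K E : Type*} [Field K] [Field E] [Algebra K E] [Algebra (RatXY K) E]

/-- A factorization `h = c * H` with `c` a polynomial and `H` hyperexponential with logarithmic
derivatives `U / w` and `V / w`, subject to bounds on the degrees of `w`, `U` and `V`. -/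
structure Presentation (D : DiffExt K E) (h : E) (μ ν γ : ℕ) where
  (c w U V : Poly K)
  H : E
  c_ne : c ≠ 0
  w_ne : w ≠ 0
  H_ne : H ≠ 0
  h_eq : h = incl K E c * H
  Dx_H : D.Dx H * incl K E w = incl K E U * H
  Dy_H : D.Dy H * incl K E w = incl K E V * H
  degX_w : degreeOf 0 w ≤ μ
  degY_w : degreeOf 1 w ≤ γ
  degX_U : degreeOf 0 U ≤ μ
  degY_U : degreeOf 1 U ≤ γ
  degX_V : degreeOf 0 V ≤ ν
  -- The factor `X 1` says that `V` is zero or has degree at most `γ - 1`, with no truncated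
  -- subtraction.
  degY_V : degreeOf 1 (X 1 * V) ≤ γ
  le : μ ≤ ν

namespace Presentation

variable {D : DiffExt K E} {h : E} {μ ν γ : ℕ} (P : Presentation D h μ ν γ)

/-- The numerator of `Dx ^ i h`, whose denominator is `w ^ i`. -/
noncomputable def num : ℕ → Poly K
  | 0 => P.c
  | i + 1 => pderiv 0 (num i) * P.w - C (i : K) * num i * pderiv 0 P.w + num i * P.U

/-- The numerator of `Dy (q * w ^ (1 - r) * H)`, whose denominator is `w ^ r`. -/
noncomputable def certNum (r : ℕ) : Poly K →ₗ[K] Poly K :=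
  (LinearMap.mulRight K P.w).comp (pderiv 1).toLinearMap +
    LinearMap.mulRight K (C (1 - r : K) * pderiv 1 P.w + P.V)

theorem certNum_apply (r : ℕ) (q : Poly K) :
    P.certNum r q = pderiv 1 q * P.w + q * (C (1 - r : K) * pderiv 1 P.w + P.V) := by
  simp [certNum]

/-- The numerator of the left hand side of a relation, whose denominator is `w ^ r`. -/
noncomputable def teleNum (r d : ℕ) : (Fin (r + 1) → Fin (d + 1) → K) →ₗ[K] Poly K :=
  ∑ i : Fin (r + 1), (LinearMap.mulRight K (P.num i * P.w ^ (r - i))).comp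
    ((Polynomial.aeval (X 0 : Poly K)).toLinearMap.comp
      ((polyOfCoeffs K d).comp (LinearMap.proj i)))

theorem teleNum_apply (r d : ℕ) (f : Fin (r + 1) → Fin (d + 1) → K) :
    P.teleNum r d f = ∑ i : Fin (r + 1), Polynomial.aeval (X 0) (polyOfCoeffs K d (f i)) *
      (P.num i * P.w ^ (r - i)) := by
  simp [teleNum, mul_assoc]

theorem degreeOf_zero_num_le (i : ℕ) : degreeOf 0 (P.num i) ≤ degreeOf 0 P.c + i * μ := by
  induction i with
  | zero => simp [num]
  | succ i ih =>
    rw [num, add_mul, one_mul, ← add_assoc]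
    have h0 : degreeOf 0 (C (i : K) * P.num i) ≤ degreeOf 0 P.c + i * μ :=
      degreeOf_C_mul_le_of_le _ ih
    exact degreeOf_add_le_of_le (degreeOf_sub_le_of_le
      (degreeOf_mul_le_of_le ((degreeOf_pderiv_le 0 0 _).trans ih) P.degX_w)
      (degreeOf_mul_le_of_le h0 ((degreeOf_pderiv_le 0 0 _).trans P.degX_w)))
      (degreeOf_mul_le_of_le ih P.degX_U)

theorem degreeOf_one_num_le (i : ℕ) : degreeOf 1 (P.num i) ≤ degreeOf 1 P.c + i * γ := by
  induction i with
  | zero => simp [num]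
  | succ i ih =>
    rw [num, add_mul, one_mul, ← add_assoc]
    have h0 : degreeOf 1 (C (i : K) * P.num i) ≤ degreeOf 1 P.c + i * γ :=
      degreeOf_C_mul_le_of_le _ ih
    exact degreeOf_add_le_of_le (degreeOf_sub_le_of_le
      (degreeOf_mul_le_of_le ((degreeOf_pderiv_le 0 1 _).trans ih) P.degY_w)
      (degreeOf_mul_le_of_le h0 ((degreeOf_pderiv_le 0 1 _).trans P.degY_w)))
      (degreeOf_mul_le_of_le ih P.degY_U)

theorem degreeOf_zero_teleNum_le (r d : ℕ) (f : Fin (r + 1) → Fin (d + 1) → K) :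
    degreeOf 0 (P.teleNum r d f) ≤ degreeOf 0 P.c + r * μ + d := by
  rw [teleNum_apply]
  refine degreeOf_sum_le_of_le fun i _ => ?_
  refine (degreeOf_mul_le_of_le
    ((degreeOf_zero_aeval_le _).trans (natDegree_polyOfCoeffs_le d (f i)))
    (degreeOf_mul_le_of_le (P.degreeOf_zero_num_le i) ((degreeOf_pow_le 0 P.w _).trans
      (Nat.mul_le_mul_left _ P.degX_w)))).trans (le_of_eq ?_)
  have : r * μ = i * μ + (r - i) * μ := by rw [← add_mul, Nat.add_sub_cancel' i.is_le]
  omega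

theorem degreeOf_one_teleNum_le (r d : ℕ) (f : Fin (r + 1) → Fin (d + 1) → K) :
    degreeOf 1 (P.teleNum r d f) ≤ degreeOf 1 P.c + r * γ := by
  rw [teleNum_apply]
  refine degreeOf_sum_le_of_le fun i _ => ?_
  refine (degreeOf_mul_le_of_le (degreeOf_one_aeval _).le
    (degreeOf_mul_le_of_le (P.degreeOf_one_num_le i) ((degreeOf_pow_le 1 P.w _).trans
      (Nat.mul_le_mul_left _ P.degY_w)))).trans (le_of_eq ?_)
  have : r * γ = i * γ + (r - i) * γ := by rw [← add_mul, Nat.add_sub_cancel' i.is_le]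
  omega

theorem degreeOf_zero_certNum_le (r : ℕ) (q : Poly K) :
    degreeOf 0 (P.certNum r q) ≤ degreeOf 0 q + ν := by
  rw [certNum_apply]
  exact degreeOf_add_le_of_le
    (degreeOf_mul_le_of_le (degreeOf_pderiv_le 1 0 q) (P.degX_w.trans P.le))
    (degreeOf_mul_le_of_le le_rfl (degreeOf_add_le_of_le
      (degreeOf_C_mul_le_of_le _ ((degreeOf_pderiv_le 1 0 _).trans (P.degX_w.trans P.le)))
      P.degX_V))

theorem degreeOf_one_X_mul_certNum_le (r : ℕ) (q : Poly K) :
    degreeOf 1 (X 1 * P.certNum r q) ≤ degreeOf 1 q + γ := by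
  have : X 1 * P.certNum r q = X 1 * pderiv 1 q * P.w +
      q * (C (1 - r : K) * (X 1 * pderiv 1 P.w) + X 1 * P.V) := by
    rw [certNum_apply]; ring
  rw [this]
  exact degreeOf_add_le_of_le (degreeOf_mul_le_of_le (degreeOf_X_mul_pderiv_le 1 1 q) P.degY_w)
    (degreeOf_mul_le_of_le le_rfl (degreeOf_add_le_of_le
      (degreeOf_C_mul_le_of_le _ ((degreeOf_X_mul_pderiv_le 1 1 _).trans P.degY_w)) P.degY_V))

theorem iterate_Dx [IsScalarTower K (RatXY K) E] (i : ℕ) :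
    (⇑D.Dx)^[i] h * incl K E P.w ^ i = incl K E (P.num i) * P.H := by
  have hw := incl_ne_zero (E := E) P.w_ne
  induction i with
  | zero => simpa [num] using P.h_eq
  | succ i ih =>
    have h1 := congrArg D.Dx ih
    rw [Derivation.leibniz, Derivation.leibniz, Derivation.leibniz_pow, D.Dx_incl, D.Dx_incl] at h1
    simp only [smul_eq_mul, nsmul_eq_mul] at h1
    rw [Function.iterate_succ_apply', num]
    simp only [map_add, map_sub, map_mul, map_natCast]
    -- The subtraction is truncated at `i = 0`, where the factor `i` kills both sides.
    have h2 : (i : E) * incl K E P.w ^ (i - 1) * incl K E P.w = i * incl K E P.w ^ i := by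
      rcases i with _ | i
      · simp
      · rw [Nat.add_sub_cancel, pow_succ, mul_assoc]
    have h3 := P.Dx_H
    linear_combination incl K E P.w * h1 + incl K E (P.num i) * h3 -
      (i * incl K E (pderiv 0 P.w)) * ih - (⇑D.Dx)^[i] h * incl K E (pderiv 0 P.w) * h2

theorem Dy_cert [IsScalarTower K (RatXY K) E] (r : ℕ) (q : Poly K) :
    D.Dy (incl K E (q * P.w) * (incl K E (P.w ^ r))⁻¹ * P.H) * incl K E P.w ^ r =
      incl K E (P.certNum r q) * P.H := by
  have hw := incl_ne_zero (E := E) P.w_ne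
  have hr := pow_ne_zero r hw
  set z := incl K E (q * P.w) * (incl K E (P.w ^ r))⁻¹ * P.H with hz
  have h0 : z * incl K E P.w ^ r = incl K E (q * P.w) * P.H := by
    rw [hz, map_pow]; field_simp
  clear_value z
  have h1 := congrArg D.Dy h0
  rw [Derivation.leibniz, Derivation.leibniz, Derivation.leibniz_pow, D.Dy_incl, D.Dy_incl,
    pderiv_mul] at h1
  simp only [smul_eq_mul, nsmul_eq_mul] at h1
  rw [certNum_apply]
  simp only [map_add, map_sub, map_mul, map_natCast, map_one] at h0 h1 ⊢
  have h2 : (r : E) * incl K E P.w ^ (r - 1) * incl K E P.w = r * incl K E P.w ^ r := by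
    rcases r with _ | r
    · simp
    · rw [Nat.add_sub_cancel, pow_succ, mul_assoc]
  refine mul_left_cancel₀ hw ?_
  linear_combination incl K E P.w * h1 + incl K E P.w * incl K E q * P.Dy_H -
    (r * incl K E (pderiv 1 P.w)) * h0 - z * incl K E (pderiv 1 P.w) * h2

theorem isHyperexponential_H : D.IsHyperexponential P.H := by
  have hw := incl_ne_zero (E := E) P.w_ne
  refine ⟨P.H_ne, ⟨algebraMap (Poly K) (RatXY K) P.U / algebraMap (Poly K) (RatXY K) P.w, ?_⟩,
    ⟨algebraMap (Poly K) (RatXY K) P.V / algebraMap (Poly K) (RatXY K) P.w, ?_⟩⟩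
  · rw [map_div₀]
    exact (div_eq_div_iff P.H_ne hw).2 P.Dx_H
  · rw [map_div₀]
    exact (div_eq_div_iff P.H_ne hw).2 P.Dy_H

theorem hasRelationLE_of_eq [IsScalarTower K (RatXY K) E] {r d : ℕ}
    {f : Fin (r + 1) → Fin (d + 1) → K} {q : Poly K} (hf : f ≠ 0)
    (hq : P.teleNum r d f = P.certNum r q) : D.HasRelationLE h r d := by
  have hw := incl_ne_zero (E := E) P.w_ne
  let p : ℕ → Polynomial K := fun i => if hi : i < r + 1 then polyOfCoeffs K d (f ⟨i, hi⟩) else 0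
  have hp : ∀ i : Fin (r + 1), p i = polyOfCoeffs K d (f i) := fun i => dif_pos i.2
  refine ⟨p, incl K E (q * P.w) * (incl K E (P.w ^ r))⁻¹ * P.H, ?_, ?_, ?_, ?_⟩
  · obtain ⟨i, hi⟩ := Function.ne_iff.1 hf
    exact ⟨i, i.is_le, by rw [hp]; exact polyOfCoeffs_ne_zero hi⟩
  · intro i hi
    rw [show p i = polyOfCoeffs K d (f ⟨i, by omega⟩) from dif_pos (by omega)]
    exact natDegree_polyOfCoeffs_le _ _
  · rcases eq_or_ne q 0 with rfl | hq0
    · exact Or.inl (by simp)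
    · exact Or.inr (((DiffExt.isHyperexponential_incl D (mul_ne_zero hq0 P.w_ne)).mul
        (DiffExt.isHyperexponential_incl D (pow_ne_zero r P.w_ne)).inv).mul P.isHyperexponential_H)
  · refine mul_right_cancel₀ (pow_ne_zero r hw) ?_
    rw [P.Dy_cert, ← hq, teleNum_apply, map_sum, Finset.sum_mul, Finset.sum_mul,
      Finset.sum_range fun i => inclX K E (p i) * (⇑D.Dx)^[i] h * incl K E P.w ^ r]
    refine Finset.sum_congr rfl fun i _ => ?_
    have h1 := P.iterate_Dx i
    rw [hp, inclX_apply, map_mul, map_mul, map_pow]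
    have h2 : incl K E P.w ^ r = incl K E P.w ^ (i : ℕ) * incl K E P.w ^ (r - i) := by
      rw [← pow_add, Nat.add_sub_cancel' i.is_le]
    rw [h2]
    linear_combination incl K E (Polynomial.aeval (X 0) (polyOfCoeffs K d (f i))) *
      incl K E P.w ^ (r - i) * h1

end Presentation
end Presentation
-- Counting unknowns and equations
namespace Presentation

variable {K E : Type*} [Field K] [Field E] [Algebra K E] [Algebra (RatXY K) E]
  {D : DiffExt K E} {h : E} {μ ν γ : ℕ} (P : Presentation D h μ ν γ)

/-- The map from the coefficients of `q` to those of `certNum r q`. -/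
noncomputable def certMap (r s m : ℕ) :
    (Fin (s + 1) × Fin (m + 1) → K) →ₗ[K] (Fin (s + ν + 1) × Fin (m + γ) → K) :=
  (coeffs K (s + ν + 1) (m + γ)).comp ((P.certNum r).comp (ofCoeffs K (s + 1) (m + 1)))

theorem degreeOf_one_certNum_lt {r m : ℕ} {q : Poly K} (hq : degreeOf 1 q ≤ m)
    (h0 : P.certNum r q ≠ 0) : degreeOf 1 (P.certNum r q) < m + γ := by
  have := P.degreeOf_one_X_mul_certNum_le r q
  rw [degreeOf_X_mul_self h0] at this
  omega

theorem certNum_eq_zero_of_mem_ker {r s m : ℕ} {f : Fin (s + 1) × Fin (m + 1) → K}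
    (hf : f ∈ LinearMap.ker (P.certMap r s m)) :
    P.certNum r (ofCoeffs K (s + 1) (m + 1) f) = 0 := by
  by_contra h0
  have h1 := P.degreeOf_zero_certNum_le r (ofCoeffs K (s + 1) (m + 1) f)
  have h2 := degreeOf_ofCoeffs_zero_le s (m + 1) f
  have h3 := P.degreeOf_one_certNum_lt (degreeOf_ofCoeffs_one_le (s + 1) m f) h0
  exact h0 (eq_zero_of_coeffs_eq_zero (by omega) h3 hf)

/-- Two solutions have zero Wronskian in `y`, hence the same degree `j` in `y`. A solution is
therefore zero once its `s + 1` coefficients at `y ^ j` vanish. -/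
theorem finrank_ker_certMap_le [CharZero K] (r s m : ℕ) :
    Module.finrank K (LinearMap.ker (P.certMap r s m)) ≤ s + 1 := by
  rcases eq_or_ne (LinearMap.ker (P.certMap r s m)) ⊥ with hbot | hbot
  · rw [hbot, finrank_bot]; omega
  obtain ⟨f₀, hf₀, hne⟩ := Submodule.exists_mem_ne_zero_of_ne_bot hbot
  have inj := ofCoeffs_injective (K := K) (s + 1) (m + 1)
  have hq₀ := (map_ne_zero_iff _ inj).2 hne
  let j : Fin (m + 1) := ⟨degreeOf 1 (ofCoeffs K (s + 1) (m + 1) f₀),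
    Nat.lt_succ_of_le (degreeOf_ofCoeffs_one_le _ _ f₀)⟩
  let π : LinearMap.ker (P.certMap r s m) →ₗ[K] (Fin (s + 1) → K) :=
    (LinearMap.funLeft K K fun i => (i, j)).comp (LinearMap.ker (P.certMap r s m)).subtype
  have hπ : Function.Injective π := by
    rw [← LinearMap.ker_eq_bot, LinearMap.ker_eq_bot']
    rintro ⟨f, hf⟩ hfπ
    by_contra hf0
    have hf0 : f ≠ 0 := fun h => hf0 (Subtype.ext h)
    have hq := (map_ne_zero_iff _ inj).2 hf0
    have e₁ := P.certNum_eq_zero_of_mem_ker hf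
    have e₀ := P.certNum_eq_zero_of_mem_ker hf₀
    rw [certNum_apply] at e₁ e₀
    have hdeg : degreeOf 1 (ofCoeffs K (s + 1) (m + 1) f) = j := by
      refine degreeOf_eq_of_mul_pderiv_eq hq hq₀ (mul_right_cancel₀ P.w_ne ?_)
      linear_combination ofCoeffs K (s + 1) (m + 1) f * e₀ - ofCoeffs K (s + 1) (m + 1) f₀ * e₁
    obtain ⟨e, he, he1⟩ := exists_coeff_ne_zero_of_degreeOf (i := 1) hq
    have he0 := (monomial_le_degreeOf 0 he).trans (degreeOf_ofCoeffs_zero_le s (m + 1) f)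
    have h1 := congrFun (coeffs_ofCoeffs (s + 1) (m + 1) f) (⟨e 0, by omega⟩, j)
    rw [coeffs_apply, ← hdeg, ← he1, expXY_eta] at h1
    have h2 := congrFun hfπ ⟨e 0, by omega⟩
    exact mem_support_iff.1 he (h1.trans h2)
  simpa using LinearMap.finrank_le_finrank_of_injective hπ

/-- The bounds `s` and `m` on the degrees of `q` make both sides fit in the same box: degree at most
`s + ν` in `x` and less than `m + γ` in `y`. -/
theorem hasRelationLE_of_count [IsScalarTower K (RatXY K) E] {r d s m n : ℕ}
    (hs : s + ν = degreeOf 0 P.c + r * μ + d) (hm : m + γ = degreeOf 1 P.c + r * γ + 1)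
    (hker : Module.finrank K (LinearMap.ker (P.certMap r s m)) ≤ n)
    (hcount : (s + ν + 1) * (m + γ) + n < (r + 1) * (d + 1) + (s + 1) * (m + 1)) :
    D.HasRelationLE h r d := by
  obtain ⟨f, g, hf, hfg⟩ := exists_eq_of_finrank_lt
    ((coeffs K (s + ν + 1) (m + γ)).comp (P.teleNum r d)) (P.certMap r s m) (by
      simp only [Module.finrank_pi, Module.finrank_pi_fintype, Fintype.card_prod, Fintype.card_fin,
        Finset.sum_const, Finset.card_univ, smul_eq_mul]
      omega)
  refine P.hasRelationLE_of_eq hf (q := ofCoeffs K (s + 1) (m + 1) g) (sub_eq_zero.1 ?_)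
  refine eq_zero_of_coeffs_eq_zero (s := s + ν + 1) (n := m + γ) ?_ ?_
    (by rw [map_sub]; exact sub_eq_zero.2 hfg)
  · refine Nat.lt_succ_of_le (degreeOf_sub_le_of_le ?_ ?_)
    · rw [hs]; exact P.degreeOf_zero_teleNum_le r d f
    · exact (P.degreeOf_zero_certNum_le r _).trans
        (Nat.add_le_add_right (degreeOf_ofCoeffs_zero_le s (m + 1) g) ν)
  · rw [hm]
    refine Nat.lt_succ_of_le (degreeOf_sub_le_of_le (P.degreeOf_one_teleNum_le r d f) ?_)
    by_cases h0 : P.certNum r (ofCoeffs K (s + 1) (m + 1) g) = 0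
    · simp [h0]
    · have := P.degreeOf_one_certNum_lt (degreeOf_ofCoeffs_one_le (s + 1) m g) h0
      omega

/-- The space of all `q` with `certNum r q = 0` in the ansatz for the certificate has dimension at
most `φ` over `K(x)`. -/
def KerBound (φ : ℕ) : Prop :=
  ∀ r s m : ℕ, m + γ = degreeOf 1 P.c + r * γ + 1 →
    Module.finrank K (LinearMap.ker (P.certMap r s m)) ≤ φ * (s + 1)

theorem kerBound_one [CharZero K] : P.KerBound 1 := fun r s m _ => by
  rw [one_mul]; exact P.finrank_ker_certMap_le r s m

theorem kerBound_zero (H : ∀ (r : ℕ) (q : Poly K), q ≠ 0 →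
    degreeOf 1 q + γ ≤ degreeOf 1 P.c + r * γ + 1 → P.certNum r q ≠ 0) : P.KerBound 0 := by
  intro r s m hm
  have : LinearMap.ker (P.certMap r s m) = ⊥ := by
    rw [eq_bot_iff]
    intro f hf
    by_contra hf0
    refine H r _ ((map_ne_zero_iff _ (ofCoeffs_injective (s + 1) (m + 1))).2 hf0) ?_
      (P.certNum_eq_zero_of_mem_ker hf)
    have := degreeOf_ofCoeffs_one_le (s + 1) m f
    omega
  rw [this, finrank_bot]; omega

variable {P}

/-- The surplus is `(r + 1) * (d + 1) - r * (s + 1) - ν * (m + γ)`. Since `s` grows like `d`, the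
coefficient of `d` is `1`, and a large `d` suffices. -/
theorem KerBound.exists_hasRelationLE_order [IsScalarTower K (RatXY K) E] {φ r : ℕ}
    (H : P.KerBound φ) (hr : r + 1 = γ + φ) (hφ : φ ≤ 1) : ∃ d, D.HasRelationLE h r d := by
  set A := degreeOf 0 P.c with hA
  set B := degreeOf 1 P.c with hB
  let Y := B + r * γ + 1
  -- This choice keeps `s` nonnegative and makes the surplus `ν + r * ν + 1`.
  let d := ν + r * (A + r * μ) + ν * Y
  have hγ : γ ≤ B + r * γ + 1 := by
    rcases Nat.eq_zero_or_pos r with rfl | hr0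
    · omega
    · have := Nat.le_mul_of_pos_left γ hr0
      omega
  obtain ⟨m, hm⟩ := Nat.exists_eq_add_of_le' hγ
  obtain ⟨s, hs⟩ : ∃ s, A + r * μ + d = s + ν :=
    ⟨A + r * μ + (r * (A + r * μ) + ν * Y), by simp only [d]; ring⟩
  refine ⟨d, P.hasRelationLE_of_count hs.symm hm.symm (H r s m hm.symm) ?_⟩
  have hs' : (s : ℤ) = A + r * μ + r * (A + r * μ) + ν * (m + γ) := by
    have : s = A + r * μ + (r * (A + r * μ) + ν * Y) := by
      have : s + ν = A + r * μ + (r * (A + r * μ) + ν * Y) + ν := by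
        rw [← hs]; simp only [d]; ring
      omega
    rw [this, show Y = m + γ from hm]; push_cast; ring
  have hd' : (d : ℤ) = ν + r * (A + r * μ) + ν * (m + γ) := by
    simp only [d, show Y = m + γ from hm]; push_cast; ring
  have hr' : (r : ℤ) + 1 = γ + φ := by exact_mod_cast hr
  zify
  have h1 : (0 : ℤ) ≤ r * ν := by positivity
  have h2 : ((r : ℤ) + 1) * (d + 1) + (s + 1) * (m + 1) -
      ((s + ν + 1) * (m + γ) + φ * (s + 1)) =
      (r + 1) * (d + 1) - (r * (s + 1) + ν * (m + γ)) := by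
    linear_combination ((s : ℤ) + 1) * hr'
  have h3 : ((s : ℤ) + 1) = A + r * μ + d + 1 - ν := by rw [hs', hd']; ring
  rw [h3] at h2
  have h4 : ((r : ℤ) + 1) * (d + 1) - (r * (A + r * μ + d + 1 - ν) + ν * (m + γ)) =
      ν + r * ν + 1 := by
    linear_combination hd'
  have h5 : (0 : ℤ) ≤ ν := by positivity
  rw [h3] at *
  linarith

/-- As a function of `r` the surplus has slope `d + 1 - (μ * g + ν * γ) ≥ 1`, so a large `r`
suffices. -/
theorem KerBound.exists_hasRelationLE_degree [IsScalarTower K (RatXY K) E] {φ d g : ℕ}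
    (H : P.KerBound φ) (hg : g + 1 = γ + φ) (hd : μ * g + ν * γ ≤ d) (hν : ν ≤ d) :
    ∃ r, D.HasRelationLE h r d := by
  set A := degreeOf 0 P.c with hA
  set B := degreeOf 1 P.c with hB
  -- The first two summands outweigh the terms of the count independent of `r`; the last gives `γ ≤
  -- r`, which is used to make `m` a natural number.
  let r := g * (A + d + 1) + ν * (B + 1) + γ
  have hγ : γ ≤ B + r * γ + 1 := by
    have h1 : γ ≤ r := Nat.le_add_left _ _
    rcases Nat.eq_zero_or_pos γ with hγ | hγ
    · omega
    · have := Nat.le_mul_of_pos_left γ (hγ.trans_le h1)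
      omega
  obtain ⟨m, hm⟩ := Nat.exists_eq_add_of_le' hγ
  obtain ⟨s, hs⟩ : ∃ s, A + r * μ + d = s + ν := Nat.exists_eq_add_of_le' (by omega)
  refine ⟨r, P.hasRelationLE_of_count hs.symm hm.symm (H r s m hm.symm) ?_⟩
  have hr' : (r : ℤ) = g * (A + d + 1) + ν * (B + 1) + γ := by simp only [r]; push_cast; ring
  have hs' : (s : ℤ) = A + r * μ + d - ν := by
    have : ((A : ℤ) + r * μ + d) = s + ν := by exact_mod_cast hs
    linarith
  have hm' : (m : ℤ) + γ = B + r * γ + 1 := by exact_mod_cast hm.symm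
  have hg' : (g : ℤ) + 1 = γ + φ := by exact_mod_cast hg
  have hd' : (μ : ℤ) * g + ν * γ ≤ d := by exact_mod_cast hd
  zify
  have h2 : ((r : ℤ) + 1) * (d + 1) + (s + 1) * (m + 1) -
      ((s + ν + 1) * (m + γ) + φ * (s + 1)) =
      (r + 1) * (d + 1) - (g * (s + 1) + ν * (m + γ)) := by
    linear_combination ((s : ℤ) + 1) * hg'
  have h3 : ((r : ℤ) + 1) * (μ * g + ν * γ) ≤ (r + 1) * d :=
    mul_le_mul_of_nonneg_left hd' (by positivity)
  have h4 : (g : ℤ) * (s + 1) + ν * (m + γ) =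
      r * (μ * g + ν * γ) + (r - γ) - g * ν := by
    rw [hs', hm', hr']; ring
  have h5 : (0 : ℤ) ≤ g * ν := by positivity
  have h6 : (0 : ℤ) ≤ μ * g + ν * γ := by positivity
  have h7 : (0 : ℤ) ≤ γ := by positivity
  nlinarith

end Presentation

theorem degreeOf_le_sub_of_mul {K : Type*} [Field K] {j : Fin 2} {f p : Poly K} {n : ℕ}
    (hf : f ≠ 0) (h : degreeOf j (f * p) ≤ n) : degreeOf j p ≤ n - degreeOf j f := by
  rcases eq_or_ne p 0 with rfl | hp
  · simp
  · rw [degreeOf_mul_eq hf hp] at h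
    omega

/-! ### Presentations obtained from the data of the term -/

section

variable {K E : Type*} [Field K] [Field E] [Algebra K E] [Algebra (RatXY K) E]

/-- Cancelling a common factor of `w`, `U` and `V`. -/
theorem Presentation.cancel {D : DiffExt K E} {h : E} {μ ν γ : ℕ} (P : Presentation D h μ ν γ)
    {f : Poly K} (hw : f ∣ P.w) (hU : f ∣ P.U) (hV : f ∣ P.V) :
    Nonempty (Presentation D h μ ν (γ - degreeOf 1 f)) := by
  obtain ⟨w, hw⟩ := hw
  obtain ⟨U, hU⟩ := hU
  obtain ⟨V, hV⟩ := hV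
  have hf : f ≠ 0 := left_ne_zero_of_mul (hw ▸ P.w_ne)
  have hf' := incl_ne_zero (E := E) hf
  refine ⟨P.c, w, U, V, P.H, P.c_ne, right_ne_zero_of_mul (hw ▸ P.w_ne), P.H_ne, P.h_eq, ?_, ?_,
    ?_, ?_, ?_, ?_, ?_, ?_, P.le⟩
  · have := P.Dx_H
    rw [hw, hU, map_mul, map_mul] at this
    exact mul_left_cancel₀ hf' (by linear_combination this)
  · have := P.Dy_H
    rw [hw, hV, map_mul, map_mul] at this
    exact mul_left_cancel₀ hf' (by linear_combination this)
  · exact (degreeOf_le_sub_of_mul hf (hw ▸ P.degX_w)).trans (Nat.sub_le _ _)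
  · exact degreeOf_le_sub_of_mul hf (hw ▸ P.degY_w)
  · exact (degreeOf_le_sub_of_mul hf (hU ▸ P.degX_U)).trans (Nat.sub_le _ _)
  · exact degreeOf_le_sub_of_mul hf (hU ▸ P.degY_U)
  · exact (degreeOf_le_sub_of_mul hf (hV ▸ P.degX_V)).trans (Nat.sub_le _ _)
  · refine degreeOf_le_sub_of_mul hf (le_of_eq_of_le ?_ P.degY_V)
    rw [hV, mul_left_comm]

namespace TermData

variable (T : TermData K)

theorem bs_ne : T.bs ≠ 0 := T.bs_sqfp.1.ne_zero

/-- A common denominator of the logarithmic derivatives of `exp(a/b) ∏_{l ∈ s} c_l ^ e_l`. -/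
noncomputable def den (s : Finset (Fin T.L)) : Poly K := T.b * T.bs * ∏ l ∈ s, T.c l

/-- The numerator of a logarithmic derivative of `exp(a/b) ∏_{l ∈ s} c_l ^ e_l` over the
denominator `den s`, where `k` stands for `b* b' / b`. -/
noncomputable def logNum (s : Finset (Fin T.L)) (i : Fin 2) (k : Poly K) : Poly K :=
  (pderiv i T.a * T.bs - T.a * k) * ∏ l ∈ s, T.c l +
    T.b * T.bs * ∑ l ∈ s, C (T.e l) * pderiv i (T.c l) * ∏ j ∈ s.erase l, T.c j

theorem den_ne (s : Finset (Fin T.L)) : T.den s ≠ 0 :=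
  mul_ne_zero (mul_ne_zero T.b_ne T.bs_ne) (Finset.prod_ne_zero_iff.2 fun l _ => T.c_ne l)

/-- Differentiation lowers the multiplicity of a factor by at most one. Hence `b * bs`, rather than
`b ^ 2`, is a denominator for the derivative of `a/b`. -/
theorem exists_mul_eq (i : Fin 2) : ∃ k, T.b * k = T.bs * pderiv i T.b :=
  (dvd_mul_pderiv i T.b_ne fun f hf h => (T.bs_sqfp.2 f hf).2 h).imp fun _ h => h.symm

theorem mul_den_eq [IsScalarTower K (RatXY K) E] (δ : Derivation K E E) {i : Fin 2}
    (hδ : ∀ p, δ (incl K E p) = incl K E (pderiv i p)) (s : Finset (Fin T.L)) {k : Poly K}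
    (hk : T.b * k = T.bs * pderiv i T.b) :
    (δ (incl K E T.a / incl K E T.b) +
      ∑ l ∈ s, algebraMap K E (T.e l) * (δ (incl K E (T.c l)) / incl K E (T.c l))) *
      incl K E (T.den s) = incl K E (T.logNum s i k) := by
  have hb := incl_ne_zero (E := E) T.b_ne
  set z := incl K E T.a / incl K E T.b with hz
  have hzb : z * incl K E T.b = incl K E T.a := by rw [hz, div_mul_cancel₀ _ hb]
  clear_value z
  have h1 := congrArg δ hzb
  rw [Derivation.leibniz, hδ, hδ, smul_eq_mul, smul_eq_mul] at h1
  have h2 := congrArg (incl K E) hk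
  rw [map_mul, map_mul] at h2
  have h3 : (∑ l ∈ s, algebraMap K E (T.e l) * (δ (incl K E (T.c l)) / incl K E (T.c l))) *
      incl K E (∏ l ∈ s, T.c l) =
      incl K E (∑ l ∈ s, C (T.e l) * pderiv i (T.c l) * ∏ j ∈ s.erase l, T.c j) := by
    rw [map_sum, Finset.sum_mul]
    refine Finset.sum_congr rfl fun l hl => ?_
    have hc := incl_ne_zero (E := E) (T.c_ne l)
    rw [← Finset.mul_prod_erase s _ hl, hδ, map_mul, map_mul, map_mul, incl_C]
    field_simp
  rw [den, logNum]
  simp only [map_add, map_sub, map_mul] at h3 ⊢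
  linear_combination (incl K E T.bs * incl K E (∏ l ∈ s, T.c l)) * h1 +
    (z * incl K E (∏ l ∈ s, T.c l)) * h2 +
    incl K E T.b * incl K E T.bs * h3 - incl K E k * incl K E (∏ l ∈ s, T.c l) * hzb

theorem degreeOf_den_le (s : Finset (Fin T.L)) (j : Fin 2) :
    degreeOf j (T.den s) ≤ degreeOf j T.bs + degreeOf j T.b + ∑ l ∈ s, degreeOf j (T.c l) := by
  rw [add_comm (degreeOf j T.bs)]
  exact degreeOf_mul_le_of_le (degreeOf_mul_le_of_le le_rfl le_rfl) (degreeOf_prod_le _ _ _)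

/-- The operator `X i * ∂_i` raises no partial degree. For `i = j` the factor `X i` on the left then
saves one degree. -/
theorem degreeOf_X_mul_logNum_le (s : Finset (Fin T.L)) (i j : Fin 2) {k : Poly K}
    (hk : T.b * k = T.bs * pderiv i T.b) :
    degreeOf j (X i * T.logNum s i k) ≤
      degreeOf j T.bs + max (degreeOf j T.a) (degreeOf j T.b) +
        ∑ l ∈ s, degreeOf j (T.c l) := by
  have hXk : degreeOf j (X i * k) ≤ degreeOf j T.bs := by
    have h1 : degreeOf j (T.b * (X i * k)) ≤ degreeOf j T.b + degreeOf j T.bs := by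
      rw [show T.b * (X i * k) = X i * pderiv i T.b * T.bs by linear_combination X i * hk]
      exact degreeOf_mul_le_of_le (degreeOf_X_mul_pderiv_le i j _) le_rfl
    have h2 := degreeOf_le_sub_of_mul T.b_ne h1
    omega
  have hsum : X i * ∑ l ∈ s, C (T.e l) * pderiv i (T.c l) * ∏ j ∈ s.erase l, T.c j =
      ∑ l ∈ s, C (T.e l) * (X i * pderiv i (T.c l)) * ∏ j ∈ s.erase l, T.c j := by
    rw [Finset.mul_sum]
    refine Finset.sum_congr rfl fun l _ => ?_
    rw [← mul_assoc, mul_left_comm]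
  have : X i * T.logNum s i k =
      (X i * pderiv i T.a * T.bs - T.a * (X i * k)) * ∏ l ∈ s, T.c l +
      T.b * T.bs * ∑ l ∈ s, C (T.e l) * (X i * pderiv i (T.c l)) * ∏ j ∈ s.erase l, T.c j := by
    rw [logNum, ← hsum]
    generalize (∏ l ∈ s, T.c l) = p
    generalize (∑ l ∈ s, C (T.e l) * pderiv i (T.c l) * ∏ j ∈ s.erase l, T.c j) = t
    ring
  rw [this]
  have h1 : degreeOf j (X i * pderiv i T.a * T.bs - T.a * (X i * k)) ≤
      degreeOf j T.bs + max (degreeOf j T.a) (degreeOf j T.b) := by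
    have h1 := degreeOf_mul_le_of_le (degreeOf_X_mul_pderiv_le i j T.a) (le_refl (degreeOf j T.bs))
    have h2 := degreeOf_mul_le_of_le (le_refl (degreeOf j T.a)) hXk
    exact degreeOf_sub_le_of_le (h1.trans (by omega)) (h2.trans (by omega))
  have h2 : degreeOf j (T.b * T.bs) ≤
      degreeOf j T.bs + max (degreeOf j T.a) (degreeOf j T.b) :=
    (degreeOf_mul_le j T.b T.bs).trans (by omega)
  refine degreeOf_add_le_of_le (degreeOf_mul_le_of_le h1 (degreeOf_prod_le _ _ _))
    (degreeOf_mul_le_of_le h2 (degreeOf_sum_le_of_le fun l hl => ?_))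
  rw [← Finset.add_sum_erase s _ hl]
  exact degreeOf_mul_le_of_le (degreeOf_C_mul_le_of_le _ (degreeOf_X_mul_pderiv_le i j _))
    (degreeOf_prod_le _ _ _)

/-- The bounds that `μ` and `ν` have to satisfy. -/
structure XBounds (μ ν : ℕ) : Prop where
  den : degreeOf 0 T.bs + degreeOf 0 T.b + ∑ l, degreeOf 0 (T.c l) ≤ μ
  num : degreeOf 0 T.bs + max (degreeOf 0 T.a) (degreeOf 0 T.b) + ∑ l, degreeOf 0 (T.c l) ≤ ν
  -- This bounds `U`, whose degree in `x` is one lower because it comes from an `x`-derivative;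
  -- `num` bounds `V`.
  num' : degreeOf 0 T.bs + max (degreeOf 0 T.a) (degreeOf 0 T.b) + ∑ l, degreeOf 0 (T.c l) ≤ μ + 1
  le : μ ≤ ν

theorem exists_presentation [IsScalarTower K (RatXY K) E] {D : DiffExt K E} {h : E} {μ ν : ℕ}
    (hb : T.XBounds μ ν) (s : Finset (Fin T.L)) {c : Poly K} (hc : c ≠ 0) (hh : h ≠ 0)
    (hx : D.Dx h / h = D.Dx (incl K E c) / incl K E c + (D.Dx (incl K E T.a / incl K E T.b) +
      ∑ l ∈ s, algebraMap K E (T.e l) * (D.Dx (incl K E (T.c l)) / incl K E (T.c l))))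
    (hy : D.Dy h / h = D.Dy (incl K E c) / incl K E c + (D.Dy (incl K E T.a / incl K E T.b) +
      ∑ l ∈ s, algebraMap K E (T.e l) * (D.Dy (incl K E (T.c l)) / incl K E (T.c l)))) :
    ∃ P : Presentation D h μ ν (degreeOf 1 T.bs + max (degreeOf 1 T.a) (degreeOf 1 T.b) +
        ∑ l ∈ s, degreeOf 1 (T.c l)),
      ∃ kx ky, T.b * kx = T.bs * pderiv 0 T.b ∧ T.b * ky = T.bs * pderiv 1 T.b ∧
      P.c = c ∧ P.w = T.den s ∧ P.U = T.logNum s 0 kx ∧ P.V = T.logNum s 1 ky := by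
  obtain ⟨kx, hkx⟩ := T.exists_mul_eq 0
  obtain ⟨ky, hky⟩ := T.exists_mul_eq 1
  have hc' := incl_ne_zero (E := E) hc
  have hH : h / incl K E c ≠ 0 := div_ne_zero hh hc'
  have hhe : h = incl K E c * (h / incl K E c) := by rw [mul_div_cancel₀ _ hc']
  have key : ∀ (δ : Derivation K E E) (z : E), δ h / h = δ (incl K E c) / incl K E c + z →
      δ (h / incl K E c) = z * (h / incl K E c) := fun δ z hz => by
    have h1 := logDeriv_mul δ hc' hH
    rw [← hhe, hz] at h1
    rw [add_left_cancel h1, div_mul_cancel₀ _ hH]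
  have hsum : ∀ j, ∑ l ∈ s, degreeOf j (T.c l) ≤ ∑ l, degreeOf j (T.c l) := fun j =>
    Finset.sum_le_sum_of_subset (Finset.subset_univ s)
  have h00 := T.degreeOf_X_mul_logNum_le s 0 0 hkx
  have hs0 := hsum 0
  refine ⟨⟨c, T.den s, T.logNum s 0 kx, T.logNum s 1 ky, h / incl K E c, hc, T.den_ne s, hH, hhe,
    ?_, ?_, ?_, ?_, ?_, ?_, ?_, ?_, hb.le⟩, kx, ky, hkx, hky, rfl, rfl, rfl, rfl⟩
  · rw [key D.Dx _ hx, mul_right_comm, T.mul_den_eq D.Dx D.Dx_incl s hkx]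
  · rw [key D.Dy _ hy, mul_right_comm, T.mul_den_eq D.Dy D.Dy_incl s hky]
  · have := hb.den
    exact (T.degreeOf_den_le s 0).trans (by omega)
  · exact (T.degreeOf_den_le s 1).trans (by omega)
  · have := hb.num'
    rcases eq_or_ne (T.logNum s 0 kx) 0 with h0 | h0
    · simp [h0]
    · rw [degreeOf_X_mul_self h0] at h00
      omega
  · exact (degreeOf_le_degreeOf_X_mul 0 1 _).trans (T.degreeOf_X_mul_logNum_le s 0 1 hkx)
  · have := hb.num
    exact (degreeOf_le_degreeOf_X_mul 1 0 _).trans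
      ((T.degreeOf_X_mul_logNum_le s 1 0 hky).trans (by omega))
  · exact T.degreeOf_X_mul_logNum_le s 1 1 hky

end TermData

end

/-! ### Poles along a prime, values at infinity, vanishing logarithmic sums -/

section

variable {K E : Type*} [Field K] [Field E] [Algebra K E] [Algebra (RatXY K) E]

/-- `z` is a rational function with a denominator not divisible by `f`. -/
def IsRegularAt {K E : Type*} [Field K] [Field E] [Algebra (RatXY K) E] (f : Poly K) (z : E) :
    Prop :=
  ∃ p s : Poly K, ¬ f ∣ s ∧ z * incl K E s = incl K E p

/-- `z` is a rational function which takes the value `c` at `y = ∞`. -/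
def HasValueAtInfinity {K E : Type*} [Field K] [Field E] [Algebra (RatXY K) E] (z : E) (c : K) :
    Prop :=
  ∃ u v : Poly K, v ≠ 0 ∧ z * incl K E v = incl K E u ∧
    -- That is, `u - c * v` is zero or of smaller degree in `y` than `v`.
    degreeOf 1 (X 1 * (u - C c * v)) ≤ degreeOf 1 v

namespace IsRegularAt

variable {K E : Type*} [Field K] [Field E] [Algebra (RatXY K) E] {f : Poly K} {z z' : E}

theorem of_incl (hf : Prime f) (p : Poly K) : IsRegularAt f (incl K E p) :=
  ⟨p, 1, fun h => hf.not_isUnit (isUnit_of_dvd_one h), by simp⟩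

theorem add (hf : Prime f) (h : IsRegularAt f z) (h' : IsRegularAt f z') :
    IsRegularAt f (z + z') := by
  obtain ⟨p, s, h1, h2⟩ := h
  obtain ⟨p', s', h1', h2'⟩ := h'
  refine ⟨p * s' + p' * s, s * s', fun h => (hf.dvd_or_dvd h).elim h1 h1', ?_⟩
  simp only [map_add, map_mul]
  linear_combination incl K E s' * h2 + incl K E s * h2'

theorem mul (hf : Prime f) (h : IsRegularAt f z) (h' : IsRegularAt f z') :
    IsRegularAt f (z * z') := by
  obtain ⟨p, s, h1, h2⟩ := h
  obtain ⟨p', s', h1', h2'⟩ := h'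
  refine ⟨p * p', s * s', fun h => (hf.dvd_or_dvd h).elim h1 h1', ?_⟩
  simp only [map_mul]
  linear_combination z' * incl K E s' * h2 + incl K E p * h2'

theorem sum (hf : Prime f) {ι : Type*} (s : Finset ι) {z : ι → E}
    (h : ∀ i ∈ s, IsRegularAt f (z i)) : IsRegularAt f (∑ i ∈ s, z i) := by
  classical
  induction s using Finset.induction_on with
  | empty => simpa using of_incl (E := E) hf (0 : Poly K)
  | insert i s hi ih =>
    rw [Finset.sum_insert hi]
    exact (h i (Finset.mem_insert_self i s)).add hf
      (ih fun j hj => h j (Finset.mem_insert_of_mem hj))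

theorem div {p s : Poly K} (h : ¬ f ∣ s) : IsRegularAt f (incl K E p / incl K E s) :=
  ⟨p, s, h, div_mul_cancel₀ _ (incl_ne_zero fun h0 => h (h0 ▸ dvd_zero f))⟩

theorem dvd (hf : Prime f) {p : Poly K} (h : IsRegularAt f (incl K E p / incl K E f)) :
    f ∣ p := by
  obtain ⟨u, s, h1, h2⟩ := h
  have h3 : p * s = f * u := by
    apply TermData.incl_injective K E
    have := incl_ne_zero (E := E) hf.ne_zero
    rw [map_mul, map_mul, ← h2]
    field_simp
  exact (hf.dvd_or_dvd ⟨u, h3⟩).resolve_right h1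

end IsRegularAt

namespace HasValueAtInfinity

theorem add {K E : Type*} [Field K] [Field E] [Algebra (RatXY K) E] {z z' : E}
    {c c' : K} (h : HasValueAtInfinity z c) (h' : HasValueAtInfinity z' c') :
    HasValueAtInfinity (z + z') (c + c') := by
  obtain ⟨u, v, h1, h2, h3⟩ := h
  obtain ⟨u', v', h1', h2', h3'⟩ := h'
  refine ⟨u * v' + u' * v, v * v', mul_ne_zero h1 h1', ?_, ?_⟩
  · simp only [map_add, map_mul]
    linear_combination incl K E v' * h2 + incl K E v * h2'
  · rw [degreeOf_mul_eq h1 h1', show X 1 * (u * v' + u' * v - C (c + c') * (v * v')) =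
      X 1 * (u - C c * v) * v' + v * (X 1 * (u' - C c' * v')) by rw [C_add]; ring]
    exact degreeOf_add_le_of_le (degreeOf_mul_le_of_le h3 le_rfl) (degreeOf_mul_le_of_le le_rfl h3')

theorem zero {K E : Type*} [Field K] [Field E] [Algebra (RatXY K) E] :
    HasValueAtInfinity (0 : E) (0 : K) := ⟨0, 1, one_ne_zero, by simp, by simp⟩

theorem sum {K E : Type*} [Field K] [Field E] [Algebra (RatXY K) E] {ι : Type*}
    (s : Finset ι) {z : ι → E} {c : ι → K} (h : ∀ i ∈ s, HasValueAtInfinity (z i) (c i)) :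
    HasValueAtInfinity (∑ i ∈ s, z i) (∑ i ∈ s, c i) := by
  classical
  induction s using Finset.induction_on with
  | empty => simpa using zero (K := K) (E := E)
  | insert i s hi ih =>
    rw [Finset.sum_insert hi, Finset.sum_insert hi]
    exact (h i (Finset.mem_insert_self i s)).add (ih fun j hj => h j (Finset.mem_insert_of_mem hj))

variable [IsScalarTower K (RatXY K) E]

theorem algebraMap_mul {z : E} {c : K} (h : HasValueAtInfinity z c) (k : K) :
    HasValueAtInfinity (algebraMap K E k * z) (k * c) := by
  obtain ⟨u, v, h1, h2, h3⟩ := h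
  refine ⟨C k * u, v, h1, ?_, ?_⟩
  · rw [map_mul, incl_C, mul_assoc, h2]
  · rw [show X 1 * (C k * u - C (k * c) * v) = C k * (X 1 * (u - C c * v)) by rw [C_mul]; ring]
    exact degreeOf_C_mul_le_of_le _ h3

theorem eq_zero {K E : Type*} [Field K] [Field E] [Algebra (RatXY K) E] {c : K}
    (h : HasValueAtInfinity (0 : E) c) : c = 0 := by
  obtain ⟨u, v, h1, h2, h3⟩ := h
  by_contra hc
  obtain rfl : u = 0 := by
    by_contra hu
    exact incl_ne_zero (E := E) hu (by rw [← h2, zero_mul])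
  have hC : (C c : Poly K) ≠ 0 := (map_ne_zero_iff _ (C_injective _ _)).2 hc
  rw [zero_sub, mul_neg, degreeOf_neg, degreeOf_X_mul_self (mul_ne_zero hC h1),
    degreeOf_mul_eq hC h1] at h3
  omega

theorem logDeriv (D : DiffExt K E) {p : Poly K} (hp : p ≠ 0) :
    HasValueAtInfinity (incl K E (X 1) * (D.Dy (incl K E p) / incl K E p))
      (degreeOf 1 p : K) := by
  refine ⟨X 1 * pderiv 1 p, p, hp, ?_, degreeOf_X_mul_euler_le 1 p⟩
  rw [mul_assoc, div_mul_cancel₀ _ (incl_ne_zero hp), D.Dy_incl, map_mul]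

end HasValueAtInfinity

variable [IsScalarTower K (RatXY K) E]

theorem logDeriv_pow_mul (D : DiffExt K E) {f g : Poly K} (hf : f ≠ 0) (hg : g ≠ 0) (n : ℕ) :
    D.Dy (incl K E (f ^ n * g)) / incl K E (f ^ n * g) =
      n * (incl K E (pderiv 1 f) / incl K E f) + incl K E (pderiv 1 g) / incl K E g := by
  induction n with
  | zero => simp [D.Dy_incl]
  | succ n ih =>
    rw [pow_succ', mul_assoc, map_mul, TermData.logDeriv_mul _ (incl_ne_zero hf)
      (incl_ne_zero (mul_ne_zero (pow_ne_zero n hf) hg)), ih, D.Dy_incl]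
    push_cast
    ring

variable {ι : Type*} [Fintype ι] {e : ι → K} {p : ι → Poly K}

/-- Multiply the relation by `y` and evaluate at `y = ∞`, where `y * p_y / p` takes the value `deg_y
p`. -/
theorem sum_mul_degree_eq_zero (D : DiffExt K E) (hp : ∀ i, p i ≠ 0)
    (h : ∑ i, algebraMap K E (e i) * (D.Dy (incl K E (p i)) / incl K E (p i)) = 0) :
    ∑ i, e i * (degreeOf 1 (p i) : K) = 0 := by
  have h1 := HasValueAtInfinity.sum Finset.univ fun i (_ : i ∈ Finset.univ) =>
    (HasValueAtInfinity.logDeriv D (hp i)).algebraMap_mul (e i)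
  simp only [mul_left_comm (algebraMap K E _)] at h1
  rw [← Finset.mul_sum, h, mul_zero] at h1
  exact h1.eq_zero

/-- This is the residue along `f`: the polar part of the sum is `t * f_y / f`, and `f` does not
divide `f_y`. -/
theorem sum_mul_multiplicity_eq_zero [CharZero K] (D : DiffExt K E) {f : Poly K} (hf : Prime f)
    (hdeg : degreeOf 1 f ≠ 0) {n : ι → ℕ} {g : ι → Poly K} (hg : ∀ i, ¬ f ∣ g i)
    (hp : ∀ i, p i = f ^ n i * g i)
    (h : ∑ i, algebraMap K E (e i) * (D.Dy (incl K E (p i)) / incl K E (p i)) = 0) :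
    ∑ i, e i * (n i : K) = 0 := by
  set t := ∑ i, e i * (n i : K) with ht
  have hg0 : ∀ i, g i ≠ 0 := fun i h0 => hg i (h0 ▸ dvd_zero f)
  have h1 : incl K E (C t * pderiv 1 f) / incl K E f =
      ∑ i, incl K E (C (-e i)) * (incl K E (pderiv 1 (g i)) / incl K E (g i)) := by
    rw [map_mul, incl_C, ht, map_sum, mul_div_assoc, Finset.sum_mul, ← sub_eq_zero,
      ← Finset.sum_sub_distrib, ← h]
    refine Finset.sum_congr rfl fun i _ => ?_
    rw [hp i, logDeriv_pow_mul D hf.ne_zero (hg0 i), incl_C, map_mul, map_neg, map_natCast]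
    ring
  have h2 : IsRegularAt f (incl K E (C t * pderiv 1 f) / incl K E f) := by
    rw [h1]
    exact IsRegularAt.sum hf _ fun i _ =>
      (IsRegularAt.of_incl hf _).mul hf (IsRegularAt.div (hg i))
  rcases hf.dvd_or_dvd (h2.dvd hf) with h3 | h3
  · by_contra ht0
    exact hf.not_isUnit (isUnit_of_dvd_unit h3 ((Ne.isUnit ht0).map C))
  · exact absurd h3 (not_dvd_pderiv hdeg)

/-- Logarithmic derivatives have at most simple poles. -/
theorem isRegularAt_mul_logDeriv (D : DiffExt K E) {f p : Poly K} (hf : Prime f) (hp : p ≠ 0) :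
    IsRegularAt f (incl K E f * (D.Dy (incl K E p) / incl K E p)) := by
  obtain ⟨n, g, hg, rfl⟩ := exists_eq_prime_pow_mul hf hp
  have hf' := incl_ne_zero (E := E) hf.ne_zero
  rw [logDeriv_pow_mul D hf.ne_zero (right_ne_zero_of_mul hp), mul_add, mul_left_comm,
    mul_div_cancel₀ _ hf', ← map_natCast (incl K E), ← map_mul]
  exact (IsRegularAt.of_incl hf _).add hf ((IsRegularAt.of_incl hf _).mul hf (IsRegularAt.div hg))

/-- Differentiating a pole of order `n ≥ 1` gives one of order `n + 1 ≥ 2`, which a single factor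
`f` cannot clear. -/
theorem not_isRegularAt_mul_Dy_div [CharZero K] (D : DiffExt K E) {f a b : Poly K} (hf : Prime f)
    (hdeg : degreeOf 1 f ≠ 0) (hb : b ≠ 0) (hfb : f ∣ b) (hfa : ¬ f ∣ a) :
    ¬ IsRegularAt f (incl K E f * D.Dy (incl K E a / incl K E b)) := by
  rintro ⟨u, s, hs, hu⟩
  obtain ⟨n, g, hg, rfl⟩ := exists_eq_prime_pow_mul hf hb
  obtain ⟨m, rfl⟩ : ∃ m, n = m + 1 := by
    refine Nat.exists_eq_succ_of_ne_zero ?_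
    rintro rfl
    exact hg (by simpa using hfb)
  set b := f ^ (m + 1) * g with hbdef
  -- Here `R / g` is `f * b_y / b`; modulo `f`, `R` is the multiplicity times `f_y * g`, hence
  -- nonzero.
  obtain ⟨R, hRdef⟩ : ∃ R, R = C ((m : K) + 1) * pderiv 1 f * g + f * pderiv 1 g := ⟨_, rfl⟩
  have hR : pderiv 1 b * f * g = b * R := by
    rw [hRdef, hbdef, pderiv_mul, pderiv_pow, Nat.add_sub_cancel, C_add]
    simp only [map_natCast, map_one]
    push_cast
    ring
  set z := incl K E a / incl K E b with hz
  have hzb : z * incl K E b = incl K E a := div_mul_cancel₀ _ (incl_ne_zero hb)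
  clear_value z b
  have h1 := congrArg D.Dy hzb
  rw [Derivation.leibniz, D.Dy_incl, D.Dy_incl, smul_eq_mul, smul_eq_mul] at h1
  have h2 : u * b * g = s * (pderiv 1 a * f * g - a * R) := by
    apply TermData.incl_injective K E
    have h3 := congrArg (incl K E) hR
    simp only [map_mul, map_sub] at h3 ⊢
    linear_combination (-incl K E b * incl K E g) * hu +
      (incl K E s * incl K E f * incl K E g) * h1 - incl K E s * z * h3 -
      incl K E s * incl K E R * hzb
  have h3 : f ∣ pderiv 1 a * f * g - a * R := by
    refine (hf.dvd_or_dvd (h2 ▸ ?_)).resolve_left hs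
    exact (hfb.mul_left u).mul_right g
  have h4 : f ∣ a * R := by
    rwa [dvd_sub_right (((dvd_refl f).mul_left _).mul_right _)] at h3
  have h5 := (hf.dvd_or_dvd h4).resolve_left hfa
  rw [hRdef, dvd_add_left (dvd_mul_right f _)] at h5
  rcases hf.dvd_or_dvd ((hf.dvd_or_dvd h5).resolve_right hg) with h6 | h6
  · exact hf.not_isUnit (isUnit_of_dvd_unit h6 ((Ne.isUnit (Nat.cast_add_one_ne_zero m)).map C))
  · exact not_dvd_pderiv hdeg h6

/-- Simple poles cannot cancel the double poles of the derivative, so the reduced denominator is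
free of `y`. A nonzero `y`-derivative would then be polynomial in `y`, and `y` times it could not be
finite at `y = ∞`. -/
theorem Dy_div_eq_zero [CharZero K] (D : DiffExt K E) {a b : Poly K} (hb : b ≠ 0)
    (hp : ∀ i, p i ≠ 0)
    (h : D.Dy (incl K E a / incl K E b) +
      ∑ i, algebraMap K E (e i) * (D.Dy (incl K E (p i)) / incl K E (p i)) = 0) :
    D.Dy (incl K E a / incl K E b) = 0 ∧ ∃ a' b' : Poly K, b' ≠ 0 ∧ a * b' = a' * b ∧
      degreeOf 1 a' = 0 ∧ degreeOf 1 b' = 0 := by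
  obtain ⟨a', b', d, hrel, rfl, rfl⟩ := UniqueFactorizationMonoid.exists_reduced_factors' a b hb
  have hd := left_ne_zero_of_mul hb
  have hb' := right_ne_zero_of_mul hb
  have hz : incl K E (d * a') / incl K E (d * b') = incl K E a' / incl K E b' := by
    rw [map_mul, map_mul, mul_div_mul_left _ _ (incl_ne_zero hd)]
  rw [hz] at h ⊢
  have hdeg : degreeOf 1 b' = 0 := by
    by_contra h0
    obtain ⟨f, hf, hfb, hf1⟩ := exists_prime_dvd_degreeOf_ne h0
    refine not_isRegularAt_mul_Dy_div D hf hf1 hb' hfb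
      (fun hfa => hf.not_isUnit (hrel hfa hfb)) (E := E) ?_
    have h1 : incl K E f * D.Dy (incl K E a' / incl K E b') =
        ∑ i, incl K E (C (-e i)) * (incl K E f * (D.Dy (incl K E (p i)) / incl K E (p i))) := by
      rw [eq_neg_of_add_eq_zero_left h, ← Finset.sum_neg_distrib, Finset.mul_sum]
      exact Finset.sum_congr rfl fun i _ => by rw [incl_C, map_neg]; ring
    rw [h1]
    exact IsRegularAt.sum hf _ fun i _ =>
      (IsRegularAt.of_incl hf _).mul hf (isRegularAt_mul_logDeriv D hf (hp i))
  have hD : D.Dy (incl K E a' / incl K E b') * incl K E b' = incl K E (pderiv 1 a') := by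
    have h1 := congrArg D.Dy (div_mul_cancel₀ (incl K E a') (incl_ne_zero (E := E) hb'))
    rw [Derivation.leibniz, D.Dy_incl, D.Dy_incl, pderiv_eq_zero_of_degreeOf hdeg, map_zero,
      smul_zero, zero_add, smul_eq_mul, mul_comm] at h1
    exact h1
  have hinf := HasValueAtInfinity.sum Finset.univ fun i (_ : i ∈ Finset.univ) =>
    (HasValueAtInfinity.logDeriv D (hp i)).algebraMap_mul (-e i)
  have hsum : ∑ i, algebraMap K E (-e i) *
      (incl K E (X 1) * (D.Dy (incl K E (p i)) / incl K E (p i))) =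
      incl K E (X 1) * D.Dy (incl K E a' / incl K E b') := by
    rw [eq_neg_of_add_eq_zero_left h, ← Finset.sum_neg_distrib, Finset.mul_sum]
    exact Finset.sum_congr rfl fun i _ => by rw [map_neg]; ring
  rw [hsum] at hinf
  obtain ⟨u, v, hv, huv, hlow⟩ := hinf
  have hu : degreeOf 1 u ≤ degreeOf 1 v := by
    rw [← sub_add_cancel u (C (∑ i, -e i * (degreeOf 1 (p i) : K)) * v)]
    exact degreeOf_add_le_of_le ((degreeOf_le_degreeOf_X_mul 1 1 _).trans hlow)
      (degreeOf_C_mul_le_of_le _ le_rfl)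
  have hpoly : X 1 * pderiv 1 a' * v = u * b' := by
    apply TermData.incl_injective K E
    rw [map_mul, map_mul, map_mul, ← hD, ← huv]
    ring
  have ha' : pderiv 1 a' = 0 := by
    by_contra h0
    have h1 := degreeOf_mul_le_of_le hu hdeg.le
    rw [← hpoly, degreeOf_mul_eq (mul_ne_zero (X_ne_zero 1) h0) hv, degreeOf_X_mul_self h0] at h1
    omega
  refine ⟨?_, a', b', hb', by ring, degreeOf_eq_zero_of_pderiv ha', hdeg⟩
  rw [ha', map_zero] at hD
  exact (mul_eq_zero.1 hD).resolve_right (incl_ne_zero hb')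

end

theorem algebraMap_mem_adjoin_of_degreeOf {K : Type*} [Field K] {p : Poly K}
    (h : degreeOf 1 p = 0) : algebraMap (Poly K) (RatXY K) p ∈
      IntermediateField.adjoin K {algebraMap (Poly K) (RatXY K) (X 0)} := by
  have h0 : algebraMap (Poly K) (RatXY K) (X 0) ∈
      IntermediateField.adjoin K {algebraMap (Poly K) (RatXY K) (X 0)} :=
    IntermediateField.mem_adjoin_simple_self K _
  generalize IntermediateField.adjoin K {algebraMap (Poly K) (RatXY K) (X 0)} = F at *
  have key : ∀ m ∈ p.support, algebraMap (Poly K) (RatXY K) (monomial m (coeff m p)) ∈ F := by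
    intro m hm
    have h1 : m 1 = 0 := by
      have := monomial_le_degreeOf 1 hm
      omega
    have h2 : monomial m (coeff m p) = algebraMap K (Poly K) (coeff m p) * X 0 ^ m 0 := by
      rw [monomial_eq, Finsupp.prod_fintype _ _ fun i => pow_zero _, Fin.prod_univ_two, h1,
        pow_zero, mul_one, algebraMap_eq]
    rw [h2, map_mul, map_pow, ← IsScalarTower.algebraMap_apply K (Poly K) (RatXY K)]
    exact F.mul_mem (F.algebraMap_mem _) (pow_mem h0 _)
  have h3 := F.sum_mem key
  rwa [← map_sum, support_sum_monomial_coeff] at h3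

/-! ### Saving one: homogeneous solutions and the flags -/

namespace TermData

variable {K E : Type*} [Field K] [Field E] [Algebra K E] [Algebra (RatXY K) E]

/-- In the sum of products, only the summand differentiating `c l` could lose the factor `f`; it
keeps it through the second copy of `f`. -/
theorem dvd_logNum {K : Type*} [Field K] (T : TermData K) {f k : Poly K} {l : Fin T.L}
    (i : Fin 2) (hl : f ∣ T.c l)
    (h : f * f ∣ T.c l ∨ ∃ j ≠ l, f ∣ T.c j) : f ∣ T.logNum Finset.univ i k := by
  refine dvd_add ((hl.trans (Finset.dvd_prod_of_mem _ (Finset.mem_univ l))).mul_left _)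
    (Dvd.dvd.mul_left (Finset.dvd_sum fun j _ => ?_) _)
  by_cases hj : j = l
  · subst hj
    rcases h with ⟨g, hg⟩ | ⟨m, hm, hfm⟩
    · refine Dvd.dvd.mul_right (Dvd.dvd.mul_left ?_ _) _
      rw [hg, pderiv_mul, pderiv_mul]
      exact ⟨pderiv i f * g + pderiv i f * g + f * pderiv i g, by ring⟩
    · exact (hfm.trans (Finset.dvd_prod_of_mem _
        (Finset.mem_erase.2 ⟨hm, Finset.mem_univ m⟩))).mul_left _
  · exact (hl.trans (Finset.dvd_prod_of_mem _
      (Finset.mem_erase.2 ⟨Ne.symm hj, Finset.mem_univ l⟩))).mul_left _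

variable [IsScalarTower K (RatXY K) E] (T : TermData K)

/-- The common bound for the degrees in `y`. -/
noncomputable def gammaNat {K : Type*} [Field K] (T : TermData K) : ℕ :=
  degreeOf 1 T.bs + max (degreeOf 1 T.a) (degreeOf 1 T.b) + ∑ l, degreeOf 1 (T.c l)

theorem gamma_eq {K : Type*} [Field K] (T : TermData K) : T.gamma = T.gammaNat := by
  simp [gamma, gammaNat, degY]

theorem one_le_gammaNat {K : Type*} [Field K] (T : TermData K) : 1 ≤ T.gammaNat := by
  have := T.degY_ne
  simp only [degY] at this
  rw [gammaNat]
  omega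

variable {T} {D : DiffExt K E} {h : E}

/-- Either the certificate map is injective, or a homogeneous solution exists and its residues and
its degree in `y` yield a cancellation or condition (R) with the weaker inequality. -/
theorem IsTerm.presentation_cases [CharZero K] (hT : T.IsTerm D h) {μ ν : ℕ}
    (hb : T.XBounds μ ν) :
    (∃ P : Presentation D h μ ν T.gammaNat, P.KerBound 0) ∨
    (∃ γ' < T.gammaNat, Nonempty (Presentation D h μ ν γ')) ∨
    (T.RationalInY ∧ ∃ η : ℤ, T.IsEta η ∧ 0 ≤ degY T.c₀ + η + 1) := by
  obtain ⟨P, kx, ky, -, hky, hPc, hPw, hPU, hPV⟩ := T.exists_presentation hb Finset.univ T.c₀_ne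
    hT.1 (hT.2.1.trans (add_assoc _ _ _)) (hT.2.2.trans (add_assoc _ _ _))
  by_cases hker : ∀ (r : ℕ) (q : Poly K), q ≠ 0 →
      degreeOf 1 q + T.gammaNat ≤ degreeOf 1 P.c + r * T.gammaNat + 1 → P.certNum r q ≠ 0
  · exact Or.inl ⟨P, P.kerBound_zero hker⟩
  refine Or.inr ?_
  push Not at hker
  obtain ⟨r, q, hq0, hqdeg, hq⟩ := hker
  rw [P.certNum_apply] at hq
  have hw0 : T.den Finset.univ ≠ 0 := T.den_ne _
  -- The exponents `1`, `1 - r`, `e_l` belong to `q`, `w`, `c_l`: formally `q * w ^ (1 - r) *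
  -- exp(a/b) * ∏ c_l ^ e_l` is killed by `Dy`.
  let e : Option (Option (Fin T.L)) → K := fun o =>
    o.elim 1 fun o => o.elim (1 - r) T.e
  let p : Option (Option (Fin T.L)) → Poly K := fun o =>
    o.elim q fun o => o.elim (T.den Finset.univ) T.c
  have hp : ∀ o, p o ≠ 0 := by
    rintro (_ | _ | l)
    exacts [hq0, hw0, T.c_ne l]
  have hlog : D.Dy (incl K E T.a / incl K E T.b) +
      ∑ o, algebraMap K E (e o) * (D.Dy (incl K E (p o)) / incl K E (p o)) = 0 := by
    have h1 := T.mul_den_eq D.Dy D.Dy_incl Finset.univ hky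
    rw [← hPV] at h1
    have h2 := congrArg (incl K E) hq
    rw [hPw] at h2
    simp only [map_add, map_mul, map_zero] at h2
    rw [← h1, incl_C] at h2
    simp only [Fintype.sum_option, e, p, Option.elim_none, Option.elim_some, map_one, one_mul]
    have hq' := incl_ne_zero (E := E) hq0
    have hw' := incl_ne_zero (E := E) hw0
    rw [D.Dy_incl, D.Dy_incl]
    generalize (∑ l, algebraMap K E (T.e l) * (D.Dy (incl K E (T.c l)) / incl K E (T.c l))) = S at *
    generalize D.Dy (incl K E T.a / incl K E T.b) = A at *
    field_simp
    linear_combination h2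
  obtain ⟨hab, a', b', hb', hab', ha1, hb1⟩ := Dy_div_eq_zero D T.b_ne hp hlog
  rw [hab, zero_add] at hlog
  have hdegsum := sum_mul_degree_eq_zero D hp hlog
  simp only [Fintype.sum_option, e, p, Option.elim_none, Option.elim_some, one_mul] at hdegsum
  by_cases hint : ∀ l, degY (T.c l) = 0 ∨ ∃ n : ℤ, (n : K) = T.e l
  -- The value of `η` comes from `deg_y q + (1 - r) * deg_y w + η = 0`, the degree relation at
  -- infinity.
  · refine Or.inr ⟨⟨?_, hint⟩, (r - 1) * degreeOf 1 (T.den Finset.univ) - degreeOf 1 q, ?_, ?_⟩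
    · have h1 : algebraMap (Poly K) (RatXY K) T.a / algebraMap (Poly K) (RatXY K) T.b =
          algebraMap (Poly K) (RatXY K) a' / algebraMap (Poly K) (RatXY K) b' := by
        have inj := IsFractionRing.injective (Poly K) (RatXY K)
        rw [div_eq_div_iff ((map_ne_zero_iff _ inj).2 T.b_ne) ((map_ne_zero_iff _ inj).2 hb'),
          ← map_mul, ← map_mul, hab']
      rw [h1]
      exact div_mem (algebraMap_mem_adjoin_of_degreeOf ha1) (algebraMap_mem_adjoin_of_degreeOf hb1)
    · rw [IsEta]
      push_cast
      simp only [degY]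
      linear_combination -hdegsum
    -- Since `a/b` is free of `y`, `deg_y a = deg_y b` or `a = 0`; so `w` has degree exactly `γ`,
    -- and the bound on `deg_y q` turns into the inequality for `η`.
    · have hmax : max (degreeOf 1 T.a) (degreeOf 1 T.b) = degreeOf 1 T.b := by
        rcases eq_or_ne T.a 0 with h0 | h0
        · simp [h0]
        · have ha' : a' ≠ 0 := by
            rintro rfl
            rw [zero_mul] at hab'
            exact mul_ne_zero h0 hb' hab'
          have := congrArg (degreeOf 1) hab'
          rw [degreeOf_mul_eq h0 hb', degreeOf_mul_eq ha' T.b_ne] at this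
          omega
      have hden : degreeOf 1 (T.den Finset.univ) = T.gammaNat := by
        rw [den, degreeOf_mul_eq (mul_ne_zero T.b_ne T.bs_ne)
          (Finset.prod_ne_zero_iff.2 fun l _ => T.c_ne l), degreeOf_mul_eq T.b_ne T.bs_ne,
          degreeOf_prod_eq _ _ fun l _ => T.c_ne l, gammaNat, hmax]
        ring
      rw [hPc] at hqdeg
      rw [hden, degY]
      zify at hqdeg
      linarith
  · refine Or.inl ?_
    push Not at hint
    obtain ⟨l, hl, hle⟩ := hint
    obtain ⟨f, hf, hfl, hf1⟩ := exists_prime_dvd_degreeOf_ne (i := 1) (p := T.c l) hl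
    have hex := fun o => exists_eq_prime_pow_mul hf (hp o)
    choose n g hg hpg using hex
    have hmul := sum_mul_multiplicity_eq_zero D hf hf1 hg hpg hlog
    simp only [Fintype.sum_option, e, Option.elim_none, Option.elim_some, one_mul] at hmul
    -- If `f` divided `c l` only once and no other `c j`, the residue at `f` would express `e_l` as
    -- an integer.
    have hf2 : f * f ∣ T.c l ∨ ∃ j ≠ l, f ∣ T.c j := by
      by_contra hcon
      push Not at hcon
      obtain ⟨h1, h2⟩ := hcon
      have hn : ∀ j ≠ l, n (some (some j)) = 0 := fun j hj => by
        by_contra h0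
        refine h2 j hj ?_
        rw [show T.c j = _ from hpg (some (some j))]
        exact (dvd_pow_self f h0).mul_right _
      have hn1 : n (some (some l)) = 1 := by
        have h3 : T.c l = _ := hpg (some (some l))
        rcases Nat.lt_or_ge (n (some (some l))) 2 with h4 | h4
        · interval_cases h5 : n (some (some l))
          · rw [pow_zero, one_mul] at h3
            exact absurd (h3 ▸ hfl) (hg _)
          · rfl
        · refine absurd ?_ h1
          rw [h3, ← sq]
          exact (pow_dvd_pow f h4).mul_right _
      rw [Finset.sum_eq_single l (fun j _ hj => by rw [hn j hj]; simp)
        (fun h => absurd (Finset.mem_univ l) h), hn1] at hmul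
      refine hle (-(n none + (1 - r) * n (some none))) ?_
      push_cast
      push_cast at hmul
      linear_combination -hmul
    have hfw : f ∣ P.w := by
      rw [hPw]
      exact (hfl.trans (Finset.dvd_prod_of_mem _ (Finset.mem_univ l))).mul_left _
    refine ⟨_, ?_, P.cancel hfw (hPU ▸ T.dvd_logNum 0 hfl hf2) (hPV ▸ T.dvd_logNum 1 hfl hf2)⟩
    have := T.one_le_gammaNat
    rw [← gammaNat]
    omega

/-- A positive `η` needs a positive summand, so some `e_l` is a positive integer with `deg_y c_l ≠
0`. Moving `c_l ^ e_l` into the polynomial part removes `c_l` from the denominator. -/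
theorem IsTerm.exists_presentation_lt [CharZero K] (hT : T.IsTerm D h) {μ ν : ℕ}
    (hb : T.XBounds μ ν) (hR : T.RationalInY) {η : ℤ} (hη : T.IsEta η) (hpos : 0 < η) :
    ∃ γ' < T.gammaNat, Nonempty (Presentation D h μ ν γ') := by
  have hn : ∀ l, ∃ n : ℤ, T.e l * (degY (T.c l) : K) = ((n * degY (T.c l) : ℤ) : K) ∧
      (degY (T.c l) ≠ 0 → (n : K) = T.e l) := fun l => by
    rcases hR.2 l with h0 | ⟨n, hn⟩
    -- A `c l` free of `y` contributes nothing to `η`, so `0` stands in for a possibly nonintegral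
    -- `e_l`.
    · exact ⟨0, by simp [h0], fun h1 => absurd h0 h1⟩
    · exact ⟨n, by push_cast; rw [hn], fun _ => hn⟩
  choose n hn1 hn2 using hn
  have hsum : η = ∑ l, n l * degY (T.c l) := by
    have : (η : K) = ((∑ l, n l * degY (T.c l) : ℤ) : K) := by
      rw [hη, Int.cast_sum]
      exact Finset.sum_congr rfl fun l _ => hn1 l
    exact_mod_cast this
  obtain ⟨l, -, hl⟩ : ∃ l ∈ Finset.univ, 0 < n l * degY (T.c l) := by
    by_contra hcon
    push Not at hcon
    have := Finset.sum_nonpos hcon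
    omega
  have hdeg : degY (T.c l) ≠ 0 := by
    rintro h0
    simp [h0] at hl
  have hnl : 0 < n l := pos_of_mul_pos_left hl (by positivity)
  obtain ⟨m, hm⟩ := Int.eq_ofNat_of_zero_le hnl.le
  have he : T.e l = m := by
    rw [← hn2 l hdeg, hm, Int.cast_natCast]
  have hlogm : ∀ δ : Derivation K E E, δ (incl K E (T.c₀ * T.c l ^ m)) /
      incl K E (T.c₀ * T.c l ^ m) = δ (incl K E T.c₀) / incl K E T.c₀ +
      algebraMap K E (T.e l) * (δ (incl K E (T.c l)) / incl K E (T.c l)) := fun δ => by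
    have hc := incl_ne_zero (E := E) (T.c_ne l)
    rw [map_mul, map_pow, logDeriv_mul δ (incl_ne_zero T.c₀_ne) (pow_ne_zero m hc), he,
      map_natCast]
    congr 1
    clear he hm
    induction m with
    | zero => simp
    | succ m ih =>
      rw [pow_succ, logDeriv_mul δ (pow_ne_zero m hc) hc, ih]
      push_cast
      ring
  have key : ∀ δ : Derivation K E E, δ h / h = δ (incl K E T.c₀) / incl K E T.c₀ +
      δ (incl K E T.a / incl K E T.b) +
      ∑ l, algebraMap K E (T.e l) * (δ (incl K E (T.c l)) / incl K E (T.c l)) →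
      δ h / h = δ (incl K E (T.c₀ * T.c l ^ m)) / incl K E (T.c₀ * T.c l ^ m) +
      (δ (incl K E T.a / incl K E T.b) + ∑ l ∈ Finset.univ.erase l,
        algebraMap K E (T.e l) * (δ (incl K E (T.c l)) / incl K E (T.c l))) := fun δ hδ => by
    rw [hδ, hlogm, ← Finset.add_sum_erase _ _ (Finset.mem_univ l)]
    ring
  obtain ⟨P, -⟩ := T.exists_presentation hb (Finset.univ.erase l)
    (mul_ne_zero T.c₀_ne (pow_ne_zero m (T.c_ne l))) hT.1 (key D.Dx hT.2.1) (key D.Dy hT.2.2)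
  refine ⟨_, ?_, ⟨P⟩⟩
  rw [gammaNat, ← Finset.add_sum_erase Finset.univ _ (Finset.mem_univ l)]
  simp only [degY] at hdeg
  omega

theorem IsTerm.exists_relations [CharZero K] (hT : T.IsTerm D h) {φ₃ : ℤ}
    (hφ₃ : φ₃ = T.phi3 ∨ φ₃ = T.phi3') :
    ∃ g : ℕ, (g : ℤ) = T.gamma - 1 + φ₃ ∧ (g : ℤ) ≤ T.gamma + 1 - φ₃ ∧
      ∀ μ ν, T.XBounds μ ν → (∃ r ≤ g, ∃ d, D.HasRelationLE h r d) ∧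
        ∃ r, D.HasRelationLE h r (μ * g + ν * T.gammaNat) := by
  have hγ := T.one_le_gammaNat
  rw [T.gamma_eq]
  have key : ∀ (μ ν γ' φ g : ℕ) (P : Presentation D h μ ν γ'), P.KerBound φ → φ ≤ 1 →
      1 ≤ γ' + φ → γ' + φ ≤ g + 1 → γ' ≤ T.gammaNat →
      (∃ r ≤ g, ∃ d, D.HasRelationLE h r d) ∧
        ∃ r, D.HasRelationLE h r (μ * g + ν * T.gammaNat) := by
    intro μ ν γ' φ g P hP hφ h1 h2 h3
    obtain ⟨g', hg'⟩ := Nat.exists_eq_add_of_le' h1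
    refine ⟨⟨g', by omega, hP.exists_hasRelationLE_order hg'.symm hφ⟩,
      hP.exists_hasRelationLE_degree hg'.symm ?_ ?_⟩
    · exact add_le_add (Nat.mul_le_mul_left _ (by omega)) (Nat.mul_le_mul_left _ h3)
    · exact (Nat.le_mul_of_pos_right ν hγ).trans (Nat.le_add_left _ _)
  have hval : φ₃ = 1 ∨ φ₃ = 0 := by
    rcases hφ₃ with rfl | rfl
    · rw [phi3]; split_ifs <;> simp
    · rw [phi3']; split_ifs <;> simp
  rcases hval with h1 | h0
  · refine ⟨T.gammaNat, by omega, by omega, fun μ ν hb => ?_⟩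
    obtain ⟨P, -⟩ := T.exists_presentation hb Finset.univ T.c₀_ne
      hT.1 (hT.2.1.trans (add_assoc _ _ _)) (hT.2.2.trans (add_assoc _ _ _))
    exact key μ ν _ 1 _ P P.kerBound_one le_rfl (by omega) le_rfl le_rfl
  · refine ⟨T.gammaNat - 1, by omega, by omega, fun μ ν hb => ?_⟩
    have hlt : (∃ γ' < T.gammaNat, Nonempty (Presentation D h μ ν γ')) →
        (∃ r ≤ T.gammaNat - 1, ∃ d, D.HasRelationLE h r d) ∧
        ∃ r, D.HasRelationLE h r (μ * (T.gammaNat - 1) + ν * T.gammaNat) := by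
      rintro ⟨γ', h1, ⟨P⟩⟩
      exact key μ ν γ' 1 _ P P.kerBound_one le_rfl (by omega) (by omega) h1.le
    -- Injectivity gives `φ = 0`. In the other surviving cases `γ` drops by at least one, so `φ = 1`
    -- still fits the same `g`.
    rcases hT.presentation_cases hb with ⟨P, hP⟩ | h1 | ⟨hR, η, hη, h1⟩
    · exact key μ ν _ 0 _ P hP zero_le_one (by omega) (by omega) le_rfl
    · exact hlt h1
    · refine hlt (hT.exists_presentation_lt hb hR hη ?_)
      rcases hφ₃ with h2 | h2
      · rw [phi3, h0] at h2
        by_contra hcon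
        rw [if_pos ⟨hR, η, hη, by omega⟩] at h2
        exact zero_ne_one h2
      · rw [phi3', h0, if_pos ⟨hR, η, hη, h1⟩] at h2
        exact absurd h2 zero_ne_one

end TermData

end CreativeTelescoping

theorem mainTheorem2 {K E : Type*} [Field K] [CharZero K] [Field E] [Algebra K E]
    [Algebra (CreativeTelescoping.RatXY K) E] [IsScalarTower K (CreativeTelescoping.RatXY K) E]
    (D : CreativeTelescoping.DiffExt K E) (T : CreativeTelescoping.TermData K)
    (h : E) (hT : T.IsTerm D h)
    (φ₃ : ℤ) (hφ₃ : φ₃ = T.phi3 ∨ φ₃ = T.phi3') :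
    (∃ r d : ℕ, (r : ℤ) = T.gamma - 1 + φ₃ ∧ D.HasRelation h r d) ∧
    (∃ r d : ℕ, (r : ℤ) = T.gamma + 1 - φ₃ ∧ D.HasRelation h r d) ∧
    (CreativeTelescoping.degX T.b < CreativeTelescoping.degX T.a →
      ∃ r d : ℕ, (d : ℤ) = (T.alpha + T.beta) * (2 * T.gamma - 1 + φ₃) + T.gamma ∧
        D.HasRelation h r d) ∧
    (CreativeTelescoping.degX T.a ≤ CreativeTelescoping.degX T.b →
      ∃ r d : ℕ, (d : ℤ) = T.alpha * (2 * T.gamma - 1 + φ₃) ∧ D.HasRelation h r d) := by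
  obtain ⟨g, hg, hg', H⟩ := hT.exists_relations hφ₃
  have hγ := T.gamma_eq
  -- The order bound does not involve `μ` and `ν`, so any admissible pair serves.
  obtain ⟨r, hr, d, hrd⟩ := (H _ _ ⟨Nat.add_le_add_right (Nat.add_le_add_left
    (le_max_right _ _) _) _, le_rfl, Nat.le_succ _, le_rfl⟩).1
  refine ⟨?_, ?_, fun hab => ?_, fun hab => ?_⟩
  · obtain ⟨d', h1⟩ := hrd.exists_hasRelation_order hr
    exact ⟨g, d', hg, h1⟩
  · obtain ⟨g', hg''⟩ := Int.eq_ofNat_of_zero_le ((Int.natCast_nonneg g).trans hg')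
    obtain ⟨d', h1⟩ := hrd.exists_hasRelation_order (r' := g') (by omega)
    exact ⟨g', d', hg''.symm, h1⟩
  · simp only [CreativeTelescoping.degX] at hab
    obtain ⟨μ, hμ⟩ : ∃ μ, MvPolynomial.degreeOf 0 T.bs + MvPolynomial.degreeOf 0 T.a +
        ∑ l, MvPolynomial.degreeOf 0 (T.c l) = μ + 1 :=
      Nat.exists_eq_succ_of_ne_zero (by omega)
    have hmax := max_eq_left hab.le
    -- Here `μ = α + β`: the numerator `U` loses a degree in `x` but `V` does not, hence `ν = μ + 1`
    -- and the extra `γ` in the degree.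
    obtain ⟨r', h1⟩ := (H μ (μ + 1) ⟨by omega, by omega, by omega, by omega⟩).2
    obtain ⟨r'', h2⟩ := h1.exists_hasRelation_degree le_rfl
    refine ⟨r'', _, ?_, h2⟩
    have h3 : T.alpha + T.beta = μ := by
      simp only [CreativeTelescoping.TermData.alpha, CreativeTelescoping.TermData.beta,
        CreativeTelescoping.degX]
      zify at hμ
      push_cast
      linarith
    rw [h3]
    push_cast
    rw [hg, hγ]
    ring
  · simp only [CreativeTelescoping.degX] at hab
    have hmax := max_eq_right hab
    obtain ⟨μ, hμ⟩ : ∃ μ, MvPolynomial.degreeOf 0 T.bs + MvPolynomial.degreeOf 0 T.b +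
        ∑ l, MvPolynomial.degreeOf 0 (T.c l) = μ := ⟨_, rfl⟩
    -- Now the denominator dominates, and `μ = ν = α`.
    obtain ⟨r', h1⟩ := (H μ μ ⟨by omega, by omega, by omega, le_rfl⟩).2
    obtain ⟨r'', h2⟩ := h1.exists_hasRelation_degree le_rfl
    refine ⟨r'', _, ?_, h2⟩
    have h3 : T.alpha = μ := by
      simp only [CreativeTelescoping.TermData.alpha, CreativeTelescoping.degX]
      exact_mod_cast hμ
    rw [h3]
    push_cast
    rw [hg, hγ]
    ring
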